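/- **Setting.** Let $\Omega\subset\mathbb R^2$ be a bounded polygonal domain (connected, possibly with holes, with $\operatorname{int}\overline\Omega=\Omega$), whose boundary is $\partial\Omega=\overline\Gamma_c\cup\overline\Gamma_s\cup\overline\Gamma_f$ with pairwise disjoint relatively open parts. Let $E,d>0$, $\nu\in[0,\tfrac12)$, $\mathbb M\tau=\frac{Ed^3}{12(1-\nu^2)}\big((1-\nu)\tau+\nu\,\mathrm{tr}(\tau)\delta\big)$ for symmetric $2\times2$ matrices ($\delta$ the identity), and $f\in L^2(\Omega)$. Put $\widetilde U=\{v\in H^2(\Omega): v=0\text{ on }\Gamma_c\cup\Gamma_s,\ \partial_nv=0\text{ on }\Gamma_c\}$, let $u\in\widetilde U$ satisfy $\int_\Omega\mathbb M\nabla^2u:\nabla^2v=\int_\Omega fv$ for all $v\in\widetilde U$ (the weak solution of $\mathrm{div}\,\mathbf{div}\,\mathbb M\nabla^2u=f$ with clamped, simply supported and free conditions on $\Gamma_c,\Gamma_s,\Gamma_f$), and put $\sigma=\mathbb M\nabla^2u$. Let $\mathcal T_h$ be a conforming triangulation of $\overline\Omega$ such that the relative interior of every edge lies in $\Omega$, $\Gamma_c$,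 $\Gamma_s$ or $\Gamma_f$, and whose shape regularity is bounded by $\kappa$ (every $T\in\mathcal T_h$ contains a disc of some diameter $\rho>0$ with $\mathrm{diam}\,T\le\kappa\rho$). Let $h_T=\mathrm{area}(T)^{1/2}$, let $h_e$ be the length of an edge $e$, and let $\Gamma_h^c$ be the set of the edges that are interior or lie on $\Gamma_c$. On an interior edge $[\![\partial_n w]\!]$ is the jump of $\partial_n w$ across the edge, and on a boundary edge it is $\partial_nw$. Write $\|\cdot\|_T$, $\|\cdot\|_e$ for $L^2$ norms and $\nabla_h^2$ for the piecewise Hessian. Let $r\ge1$. For $m\ge 1$ let $S_h^m=\{v\in H^1(\Omega): v|_T\in\mathcal P_m(T)\ \forall T\in\mathcal T_h\}$ and $U_h^m=\{v\in S_h^m: v=0\text{ on }\Gamma_c\cup\Gamma_s\}$. Let $\Sigma_h$ be the space of symmetric $2\times2$ matrix fields $\tau$ with $\tau|_T\in\mathcal P_{r-1}(T)^{2\times2}$ for all $T$, for which $\tau_{nn}=n^{\mathsf T}\tau n$ is single-valued on interior edges and zero on the edges in $\Gamma_s\cup\Gamma_f$. With $b_h(\tau,v)=-(\tau,\nabla_h^2v)+\sum_{T}\langle\tau_{nn},\partial_nv\rangle_{\partial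 T}$, let $(\sigma_h,u_h)\in\Sigma_h\times U_h^r$ be a Hellan–Herrmann–Johnson solution: $$(\mathbb M^{-1}\sigma_h,\tau_h)+b_h(\tau_h,u_h)=0\quad\forall\tau_h\in\Sigma_h,\qquad b_h(\sigma_h,v_h)=-(f,v_h)\quad\forall v_h\in U_h^r .$$ Let $I_h^r v\in S_h^r$ denote the interpolant of a continuous $v$ that has the same values at the vertices, the same moments against $\mathcal P_{r-2}(e)$ on each edge and the same moments against $\mathcal P_{r-3}(T)$ on each triangle (polynomial spaces of negative degree are $\{0\}$), and let $W_h=(I-I_h^r)U_h^{r+1}$. Let $u_h^*=u_h+w_h$, where $w_h\in W_h$ satisfies $(\mathbb M\nabla_h^2w_h,\nabla_h^2v_h)=(\sigma_h-\mathbb M\nabla_h^2u_h,\nabla_h^2v_h)$ for all $v_h\in W_h$. Let $Q_h^r$ be the $L^2$ projection onto discontinuous piecewise polynomials of degree at most $r$. Define $$\eta_h(T)=\Big(\|\mathbb M^{-1}\sigma_h-\nabla_h^2u_h^*\|_T^2+h_T^4\|f-\mathrm{div}\,\mathbf{div}\,\sigma_h\|_T^2+\sum_{e\subset\partial T,\ e\in\Gamma_h^c}h_e^{-1}\|[\![\partial_nu_h^*]\!]\|_e^2\Big)^{1/2},$$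 $$\|w\|_{2,h,T}=\Big(\|\nabla^2w\|_T^2+\sum_{e\subset\partial T,\ e\in\Gamma_h^c}h_e^{-1}\|[\![\partial_nw]\!]\|_e^2\Big)^{1/2}.$$ **Theorem (local efficiency).** There is a constant $C>0$ that depends only on $\Omega$, $E$, $d$, $r$ and $\kappa$ (not on $\nu$, the splitting of $\partial\Omega$, $f$, $u$, the triangulation or the discrete solution) such that, for each $T\in\mathcal T_h$, $$\eta_h(T)\le C\Big(\|\sigma-\sigma_h\|_T+\|u-u_h^*\|_{2,h,T}+h_T^2\|f-Q_h^rf\|_T\Big).$$ -/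

import Mathlib

open MeasureTheory
open scoped ContDiff

/-! ### The plane, test functions, Sobolev functions -/

/-- The Euclidean plane. -/
abbrev E2 : Type := EuclideanSpace ℝ (Fin 2)

/-- `∂_i φ (x)`, the classical partial derivative. -/
noncomputable def partialD (i : Fin 2) (φ : E2 → ℝ) (x : E2) : ℝ :=
  fderiv ℝ φ x (EuclideanSpace.single i 1)

/-- Smooth functions with compact support in the whole plane. -/
def IsTest (φ : E2 → ℝ) : Prop := ContDiff ℝ ∞ φ ∧ HasCompactSupport φ

/-- `g` is the weak partial derivative `∂_i v` on the open set `Ω`. -/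
def IsWeakPartial (Ω : Set E2) (i : Fin 2) (v g : E2 → ℝ) : Prop :=
  ∀ φ : E2 → ℝ, IsTest φ → tsupport φ ⊆ Ω →
    ∫ x in Ω, v x * partialD i φ x = - ∫ x in Ω, g x * φ x

/-- `v ∈ H¹(Ω)` with weak gradient `Dv`. -/
def IsH1 (Ω : Set E2) (v : E2 → ℝ) (Dv : Fin 2 → E2 → ℝ) : Prop :=
  MemLp v 2 (volume.restrict Ω) ∧
    ∀ i, MemLp (Dv i) 2 (volume.restrict Ω) ∧ IsWeakPartial Ω i v (Dv i)

/-- `v ∈ H²(Ω)` with weak gradient `Dv` and weak Hessian `D2v`; `D2v i j = ∂_j ∂_i v`. -/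
def IsH2 (Ω : Set E2) (v : E2 → ℝ) (Dv : Fin 2 → E2 → ℝ) (D2v : Fin 2 → Fin 2 → E2 → ℝ) :
    Prop :=
  IsH1 Ω v Dv ∧ ∀ i, IsH1 Ω (Dv i) (D2v i)

/-- `v = 0` on the relatively open part `Γ` of the boundary, in the sense of traces of `H¹(Ω)`:
the boundary term `∫_{∂Ω} v φ n_i` of Green's formula is zero for all smooth `φ` that vanish near
the rest of the boundary. -/
def VanishesOn (Ω Γ : Set E2) (v : E2 → ℝ) (Dv : Fin 2 → E2 → ℝ) : Prop :=
  ∀ i : Fin 2, ∀ φ : E2 → ℝ, IsTest φ → Disjoint (tsupport φ) (frontier Ω \ Γ) →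
    ∫ x in Ω, (v x * partialD i φ x + Dv i x * φ x) = 0

/-- `∂_n v = 0` on the relatively open part `Γ` of the boundary, in the sense of (normal) traces:
the boundary term `∫_{∂Ω} (∂_n v) φ` of Green's formula for `∇v` is zero for all smooth `φ` that
vanish near the rest of the boundary. -/
def NormalDerivVanishesOn (Ω Γ : Set E2) (Dv : Fin 2 → E2 → ℝ)
    (D2v : Fin 2 → Fin 2 → E2 → ℝ) : Prop :=
  ∀ φ : E2 → ℝ, IsTest φ → Disjoint (tsupport φ) (frontier Ω \ Γ) →
    ∫ x in Ω, ((∑ i, D2v i i x) * φ x + ∑ i, Dv i x * partialD i φ x) = 0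

/-! ### The plate problem -/

/-- The Frobenius product `A : B`. -/
def frob (A B : Matrix (Fin 2) (Fin 2) ℝ) : ℝ := ∑ i, ∑ j, A i j * B i j

/-- The linear moment operator `𝕄` (Young modulus `Ey`, thickness `d`, Poisson ratio `ν`). -/
noncomputable def moment (Ey d ν : ℝ) (A : Matrix (Fin 2) (Fin 2) ℝ) :
    Matrix (Fin 2) (Fin 2) ℝ :=
  (Ey * d ^ 3 / (12 * (1 - ν ^ 2))) • ((1 - ν) • A + (ν * A.trace) • (1 : Matrix _ _ ℝ))

/-- The inverse `𝕄⁻¹` of the moment operator. -/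
noncomputable def momentInv (Ey d ν : ℝ) (A : Matrix (Fin 2) (Fin 2) ℝ) :
    Matrix (Fin 2) (Fin 2) ℝ :=
  (12 / (Ey * d ^ 3)) • ((1 + ν) • A - (ν * A.trace) • (1 : Matrix _ _ ℝ))

theorem moment_momentInv {Ey d ν : ℝ} (hE : 0 < Ey) (hd : 0 < d) (h0 : 0 ≤ ν) (h1 : ν < 1 / 2)
    (A : Matrix (Fin 2) (Fin 2) ℝ) :
    moment Ey d ν (momentInv Ey d ν A) = A ∧ momentInv Ey d ν (moment Ey d ν A) = A := by
  have h2 : (1 - ν ^ 2) ≠ 0 := by nlinarith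
  constructor <;> ext i j <;> fin_cases i <;> fin_cases j <;>
    simp [moment, momentInv, Matrix.trace, Fin.sum_univ_two] <;> field_simp <;> ring

/-- The matrix of values at `x` of a matrix of functions. -/
def matAt (S : Fin 2 → Fin 2 → E2 → ℝ) (x : E2) : Matrix (Fin 2) (Fin 2) ℝ :=
  Matrix.of fun i j => S i j x

/-- Bounded planar domain. The last condition, which every Lipschitz domain satisfies, says that
the domain does not lie on both sides of its boundary. -/
structure IsPlateDomain (Ω : Set E2) : Prop where
  isOpen : IsOpen Ω
  isConnected : IsConnected Ω
  isBounded : Bornology.IsBounded Ω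
  interior_closure : interior (closure Ω) = Ω

/-- `∂Ω` is made of relatively open, pairwise disjoint parts: clamped, simply supported, free. -/
structure IsBoundarySplitting (Ω Γc Γs Γf : Set E2) : Prop where
  open_c : ∃ V : Set E2, IsOpen V ∧ Γc = V ∩ frontier Ω
  open_s : ∃ V : Set E2, IsOpen V ∧ Γs = V ∩ frontier Ω
  open_f : ∃ V : Set E2, IsOpen V ∧ Γf = V ∩ frontier Ω
  disj_cs : Disjoint Γc Γs
  disj_cf : Disjoint Γc Γf
  disj_sf : Disjoint Γs Γf
  cover : frontier Ω = closure Γc ∪ closure Γs ∪ closure Γf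

/-- The energy space: `v ∈ H²(Ω)`, `v = 0` on `Γc ∪ Γs`, `∂_n v = 0` on `Γc`. -/
def IsEnergyFn (Ω Γc Γs : Set E2) (v : E2 → ℝ) (Dv : Fin 2 → E2 → ℝ)
    (D2v : Fin 2 → Fin 2 → E2 → ℝ) : Prop :=
  IsH2 Ω v Dv D2v ∧ VanishesOn Ω (Γc ∪ Γs) v Dv ∧ NormalDerivVanishesOn Ω Γc Dv D2v

/-- `u` (with weak gradient `Du` and weak Hessian `D2u`) is the weak solution of
`div div 𝕄∇²u = f` in `Ω`, with `u = ∂_n u = 0` on `Γc`, `u = σ_nn = 0` on `Γs` and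
`σ_nn = K(σ) = 0` on the rest of the boundary, where `σ = 𝕄∇²u`. -/
def IsPlateSolution (Ω Γc Γs : Set E2) (Ey d ν : ℝ) (f : E2 → ℝ)
    (u : E2 → ℝ) (Du : Fin 2 → E2 → ℝ) (D2u : Fin 2 → Fin 2 → E2 → ℝ) : Prop :=
  IsEnergyFn Ω Γc Γs u Du D2u ∧
    ∀ (v : E2 → ℝ) (Dv : Fin 2 → E2 → ℝ) (D2v : Fin 2 → Fin 2 → E2 → ℝ),
      IsEnergyFn Ω Γc Γs v Dv D2v →
        ∫ x in Ω, frob (moment Ey d ν (matAt D2u x)) (matAt D2v x) = ∫ x in Ω, f x * v x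

/-! ### Triangulations -/

/-- The closed simplex with the given vertices. -/
def hull (s : Finset E2) : Set E2 := convexHull ℝ (s : Set E2)

/-- An edge without its end points. -/
def openEdge (e : Finset E2) : Set E2 := hull e \ (e : Set E2)

/-- A conforming triangulation of `closure Ω` (a triangle is the set of its three vertices). -/
structure Mesh (Ω : Set E2) where
  tri : Finset (Finset E2)
  card_tri : ∀ T ∈ tri, T.card = 3
  indep : ∀ T ∈ tri, AffineIndependent ℝ ((↑) : T → E2)
  conforming : ∀ T ∈ tri, ∀ T' ∈ tri, hull T ∩ hull T' = convexHull ℝ ((T : Set E2) ∩ T')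
  cover : (⋃ T ∈ tri, hull T) = closure Ω

/-- The three edges of a triangle. -/
def triEdges (T : Finset E2) : Finset (Finset E2) := T.powersetCard 2

namespace Mesh

variable {Ω : Set E2}

/-- `e` is an edge of the mesh. -/
def IsEdge (K : Mesh Ω) (e : Finset E2) : Prop := ∃ T ∈ K.tri, e ∈ triEdges T

/-- Each edge is an interior edge, or lies on one of the three parts of the boundary. -/
def Resolves (K : Mesh Ω) (Γc Γs Γf : Set E2) : Prop :=
  ∀ e, K.IsEdge e →
    openEdge e ⊆ Ω ∨ openEdge e ⊆ Γc ∨ openEdge e ⊆ Γs ∨ openEdge e ⊆ Γf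

/-- Shape regularity: the ratio of the diameter of each triangle to the diameter `ρ` of some disc
contained in it is at most `κ`. -/
def ShapeRegular (K : Mesh Ω) (κ : ℝ) : Prop :=
  ∀ T ∈ K.tri, ∃ (x : E2) (ρ : ℝ), 0 < ρ ∧ Metric.closedBall x (ρ / 2) ⊆ hull T ∧
    Metric.diam (hull T) ≤ κ * ρ

end Mesh

/-- `h_T`, the square root of the area. -/
noncomputable def meshSize (T : Finset E2) : ℝ := Real.sqrt (volume (hull T)).toReal

/-- `h_e`, the length of an edge. -/
noncomputable def edgeLen (e : Finset E2) : ℝ := Metric.diam (hull e)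

/-- Arc length on an edge. -/
noncomputable def edgeMeasure (e : Finset E2) : Measure E2 :=
  (Measure.hausdorffMeasure 1).restrict (hull e)

open Classical in
/-- The edges of `T` that are interior or clamped. -/
noncomputable def jumpEdges (Ω Γc : Set E2) (T : Finset E2) : Finset (Finset E2) :=
  {e ∈ triEdges T | openEdge e ⊆ Ω ∨ openEdge e ⊆ Γc}

/-- The outward unit normal of the triangle `T` on its edge `e`. -/
noncomputable def outNormal (T e : Finset E2) : E2 :=
  Classical.epsilon fun n : E2 =>
    ‖n‖ = 1 ∧ (∀ a ∈ e, ∀ b ∈ e, inner ℝ n (b - a) = 0) ∧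
      ∀ a ∈ e, ∀ c ∈ T, c ∉ e → inner ℝ n (c - a) < 0

/-! ### Piecewise polynomials -/

/-- A real polynomial in the two coordinates. -/
abbrev Poly2 : Type := MvPolynomial (Fin 2) ℝ

/-- The value of a polynomial at a point of the plane. -/
noncomputable def pval (p : Poly2) (x : E2) : ℝ := MvPolynomial.eval (fun i => x i) p

/-- The Hessian of a polynomial, as a matrix of functions. -/
noncomputable def hessP (p : Poly2) (i j : Fin 2) (x : E2) : ℝ :=
  pval (MvPolynomial.pderiv j (MvPolynomial.pderiv i p)) x

/-- A scalar piecewise polynomial: one polynomial for each triangle. -/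
abbrev PW : Type := Finset E2 → Poly2

/-- A matrix-valued piecewise polynomial. -/
abbrev PWMat : Type := Finset E2 → Fin 2 → Fin 2 → Poly2

/-- The value at `x` of the polynomial matrix on `T`. -/
noncomputable def matP (τ : PWMat) (T : Finset E2) (x : E2) : Matrix (Fin 2) (Fin 2) ℝ :=
  Matrix.of fun i j => pval (τ T i j) x

/-- `n · ∇v` on the edge `e`, from inside the triangle `T`, `n` the outward normal of `T`. -/
noncomputable def normalDerivP (v : PW) (T e : Finset E2) (x : E2) : ℝ :=
  ∑ i, outNormal T e i * pval (MvPolynomial.pderiv i (v T)) x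

/-- `τ_nn = nᵀ τ n` on the edge `e`, from inside the triangle `T`. -/
noncomputable def nnP (τ : PWMat) (T e : Finset E2) (x : E2) : ℝ :=
  ∑ i, ∑ j, outNormal T e i * matP τ T x i j * outNormal T e j

/-- `div div τ` on the triangle `T`. -/
noncomputable def divDivP (τ : PWMat) (T : Finset E2) (x : E2) : ℝ :=
  ∑ i, ∑ j, pval (MvPolynomial.pderiv i (MvPolynomial.pderiv j (τ T i j))) x

namespace Mesh

variable {Ω : Set E2}

open Classical in
/-- The function on `Ω` given by a piecewise polynomial (its value on the edges, a null set, is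
immaterial). -/
noncomputable def glue (K : Mesh Ω) (v : PW) (x : E2) : ℝ :=
  ∑ T ∈ K.tri, if x ∈ interior (hull T) then pval (v T) x else 0

/-- `S_h^m`: piecewise polynomials of degree at most `m` that belong to `H¹(Ω)`. -/
def MemS (K : Mesh Ω) (m : ℕ) (v : PW) : Prop :=
  (∀ T ∈ K.tri, (v T).totalDegree ≤ m) ∧ ∃ Dv, IsH1 Ω (K.glue v) Dv

/-- `U_h^m`: the functions in `S_h^m` that vanish on `Γc ∪ Γs`. -/
def MemU (K : Mesh Ω) (Γc Γs : Set E2) (m : ℕ) (v : PW) : Prop :=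
  K.MemS m v ∧ ∃ Dv, IsH1 Ω (K.glue v) Dv ∧ VanishesOn Ω (Γc ∪ Γs) (K.glue v) Dv

/-- `Σ_h`: symmetric piecewise polynomial matrices of degree at most `r - 1` whose normal-normal
component is single-valued on interior edges and zero on `Γs ∪ Γf`. -/
def MemSigma (K : Mesh Ω) (Γs Γf : Set E2) (r : ℕ) (τ : PWMat) : Prop :=
  (∀ T ∈ K.tri, ∀ i j, τ T i j = τ T j i ∧ (τ T i j).totalDegree ≤ r - 1) ∧
  (∀ T ∈ K.tri, ∀ T' ∈ K.tri, ∀ e ∈ triEdges T, e ∈ triEdges T' → openEdge e ⊆ Ω →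
    ∀ x ∈ hull e, nnP τ T e x = nnP τ T' e x) ∧
  (∀ T ∈ K.tri, ∀ e ∈ triEdges T, openEdge e ⊆ Γs ∨ openEdge e ⊆ Γf →
    ∀ x ∈ hull e, nnP τ T e x = 0)

/-- The bilinear form `a(σ, τ) = (𝕄⁻¹ σ, τ)`. -/
noncomputable def formA (K : Mesh Ω) (Ey d ν : ℝ) (σ τ : PWMat) : ℝ :=
  ∑ T ∈ K.tri, ∫ x in hull T, frob (momentInv Ey d ν (matP σ T x)) (matP τ T x)

/-- The bilinear form `b_h(τ, v) = -(τ, ∇_h² v) + ∑_T ⟨τ_nn, ∂_n v⟩_{∂T}`. -/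
noncomputable def formB (K : Mesh Ω) (τ : PWMat) (v : PW) : ℝ :=
  ∑ T ∈ K.tri, (- (∫ x in hull T, frob (matP τ T x) (matAt (hessP (v T)) x)) +
    ∑ e ∈ triEdges T, ∫ x, nnP τ T e x * normalDerivP v T e x ∂(edgeMeasure e))

/-- The Hellan--Herrmann--Johnson method: `(σh, uh) ∈ Σ_h × U_h^r` is a discrete solution. -/
def IsHHJSolution (K : Mesh Ω) (Γc Γs Γf : Set E2) (Ey d ν : ℝ) (r : ℕ) (f : E2 → ℝ)
    (σh : PWMat) (uh : PW) : Prop :=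
  K.MemSigma Γs Γf r σh ∧ K.MemU Γc Γs r uh ∧
  (∀ τ, K.MemSigma Γs Γf r τ → K.formA Ey d ν σh τ + K.formB τ uh = 0) ∧
  (∀ v, K.MemU Γc Γs r v → K.formB σh v = - ∫ x in Ω, f x * K.glue v x)

/-- `w = I_h^r v`, the modified Lagrange interpolant in `S_h^r`: equal values at the vertices,
equal moments of degree at most `r - 2` on edges and at most `r - 3` on triangles (no condition
if that degree is negative). -/
def IsInterpolant (K : Mesh Ω) (r : ℕ) (v w : PW) : Prop :=
  K.MemS r w ∧ ∀ T ∈ K.tri,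
    (∀ z ∈ T, pval (w T) z = pval (v T) z) ∧
    (∀ e ∈ triEdges T, ∀ q : Poly2, q.totalDegree + 2 ≤ r →
      ∫ x, pval (w T) x * pval q x ∂(edgeMeasure e) =
        ∫ x, pval (v T) x * pval q x ∂(edgeMeasure e)) ∧
    (∀ q : Poly2, q.totalDegree + 3 ≤ r →
      ∫ x in hull T, pval (w T) x * pval q x = ∫ x in hull T, pval (v T) x * pval q x)

/-- The bubble space `W_h = (I - I_h^r) U_h^{r+1}`. -/
def MemW (K : Mesh Ω) (Γc Γs : Set E2) (r : ℕ) (w : PW) : Prop :=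
  ∃ v Iv : PW, K.MemU Γc Γs (r + 1) v ∧ K.IsInterpolant r v Iv ∧ ∀ T ∈ K.tri, w T = v T - Iv T

/-- `wh ∈ W_h` solves
`(𝕄 ∇_h² wh, ∇_h² v) = (σh - 𝕄 ∇_h² uh, ∇_h² v)` for all `v ∈ W_h`. -/
def IsCorrection (K : Mesh Ω) (Γc Γs : Set E2) (Ey d ν : ℝ) (r : ℕ) (σh : PWMat) (uh wh : PW) :
    Prop :=
  K.MemW Γc Γs r wh ∧ ∀ v, K.MemW Γc Γs r v →
    ∑ T ∈ K.tri, ∫ x in hull T,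
        frob (moment Ey d ν (matAt (hessP (wh T)) x)) (matAt (hessP (v T)) x) =
      ∑ T ∈ K.tri, ∫ x in hull T,
        frob (matP σh T x - moment Ey d ν (matAt (hessP (uh T)) x)) (matAt (hessP (v T)) x)

/-- `q = Q_h^r f`, the `L²` projection onto discontinuous piecewise polynomials of degree at most
`r`. -/
def IsL2Projection (K : Mesh Ω) (r : ℕ) (f : E2 → ℝ) (q : PW) : Prop :=
  ∀ T ∈ K.tri, (q T).totalDegree ≤ r ∧ ∀ p : Poly2, p.totalDegree ≤ r →
    ∫ x in hull T, pval (q T) x * pval p x = ∫ x in hull T, f x * pval p x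

/-! ### Jumps, the discrete `H²` norm, the estimator -/

open Classical in
/-- The jump `⟦∂_n v⟧` on the edge `e` of a piecewise polynomial `v`, written as the sum of the
outward normal derivatives from the triangles that contain `e`. On an interior edge this is the
difference of the two one-sided values of `∂_{n_e} v`, up to the sign fixed by the orientation of
`n_e`, on which norms do not depend; on a boundary edge it is `∂_n v`. -/
noncomputable def jumpP (K : Mesh Ω) (v : PW) (e : Finset E2) (x : E2) : ℝ :=
  ∑ T ∈ K.tri with e ∈ triEdges T, normalDerivP v T e x

/-- `J ∈ L²(e)` is the jump `⟦∂_n w⟧` (with the same sign convention) on the edge `e` of a piecewise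
`H²` function `w`, given by its gradient `Dw T` and Hessian `D2w T` on each triangle `T`. The
normal trace is understood through Green's formula on the triangles,
`∑_T ∫_T (Δw φ + ∇w · ∇φ) = ∫_e ⟦∂_n w⟧ φ`
for all smooth `φ` that vanish near all other edges. -/
def IsNormalJump (K : Mesh Ω) (Dw : Finset E2 → Fin 2 → E2 → ℝ)
    (D2w : Finset E2 → Fin 2 → Fin 2 → E2 → ℝ) (e : Finset E2) (J : E2 → ℝ) : Prop :=
  MemLp J 2 (edgeMeasure e) ∧
  ∀ φ : E2 → ℝ, IsTest φ →
    (∀ e', K.IsEdge e' → e' ≠ e → Disjoint (tsupport φ) (hull e')) →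
      ∑ T ∈ K.tri, ∫ x in hull T,
          ((∑ i, D2w T i i x) * φ x + ∑ i, Dw T i x * partialD i φ x) =
        ∫ x, J x * φ x ∂(edgeMeasure e)

open Classical in
/-- The jump `⟦∂_n w⟧` on `e` of a piecewise `H²` function; it is unique almost everywhere. -/
noncomputable def normalJump (K : Mesh Ω) (Dw : Finset E2 → Fin 2 → E2 → ℝ)
    (D2w : Finset E2 → Fin 2 → Fin 2 → E2 → ℝ) (e : Finset E2) : E2 → ℝ :=
  if h : ∃ J, K.IsNormalJump Dw D2w e J then h.choose else 0

/-- The local mesh-dependent norm `‖w‖_{2,h,T}` of a piecewise `H²` function. -/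
noncomputable def norm2h (K : Mesh Ω) (Γc : Set E2) (Dw : Finset E2 → Fin 2 → E2 → ℝ)
    (D2w : Finset E2 → Fin 2 → Fin 2 → E2 → ℝ) (T : Finset E2) : ℝ :=
  Real.sqrt ((∫ x in hull T, frob (matAt (D2w T) x) (matAt (D2w T) x)) +
    ∑ e ∈ jumpEdges Ω Γc T,
      (edgeLen e)⁻¹ * ∫ x, (K.normalJump Dw D2w e x) ^ 2 ∂(edgeMeasure e))

/-- `‖u - v‖_{2,h,T}` for `u ∈ H²(Ω)` and a piecewise polynomial `v`. -/
noncomputable def deflectionError (K : Mesh Ω) (Γc : Set E2) (Du : Fin 2 → E2 → ℝ)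
    (D2u : Fin 2 → Fin 2 → E2 → ℝ) (v : PW) (T : Finset E2) : ℝ :=
  K.norm2h Γc (fun T' i x => Du i x - pval (MvPolynomial.pderiv i (v T')) x)
    (fun T' i j x => D2u i j x - hessP (v T') i j x) T

/-- The error indicator `η_h(T)`. -/
noncomputable def estimator (K : Mesh Ω) (Γc : Set E2) (Ey d ν : ℝ) (f : E2 → ℝ)
    (σh : PWMat) (us : PW) (T : Finset E2) : ℝ :=
  Real.sqrt
    ((∫ x in hull T, frob (momentInv Ey d ν (matP σh T x) - matAt (hessP (us T)) x)
        (momentInv Ey d ν (matP σh T x) - matAt (hessP (us T)) x)) +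
      meshSize T ^ 4 * (∫ x in hull T, (f x - divDivP σh T x) ^ 2) +
      ∑ e ∈ jumpEdges Ω Γc T, (edgeLen e)⁻¹ * ∫ x, (K.jumpP us e x) ^ 2 ∂(edgeMeasure e))

end Mesh

/-- The local moment error `‖σ - σh‖_T`, `σ = 𝕄∇²u`. -/
noncomputable def momentError (Ey d ν : ℝ) (D2u : Fin 2 → Fin 2 → E2 → ℝ) (σh : PWMat)
    (T : Finset E2) : ℝ :=
  Real.sqrt (∫ x in hull T, frob (moment Ey d ν (matAt D2u x) - matP σh T x)
    (moment Ey d ν (matAt D2u x) - matP σh T x))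

/-! Each of the three parts of the estimator is bounded separately, with constants that see the
triangle only through `κ`.

Consistency: `𝕄⁻¹σh - ∇²u* = -𝕄⁻¹(σ - σh) + ∇²(u - u*)`, and `𝕄⁻¹` is bounded in the Frobenius norm
uniformly in `ν` (`frob_momentInv_le`, `integral_consistency_le`).

Jumps: `u` contributes no normal jump across interior edges and no normal derivative on clamped
ones, so the jump of `u - u*` is minus that of `u*` and the two jump sums coincide
(`Mesh.integral_normalJump_sq`). As jumps of piecewise `H²` functions are defined weakly through
Green's formula, this rests on the divergence theorem on a triangle (`integral_partialD_triangle`),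
on the almost everywhere uniqueness of the jump, and on the incidence geometry of a conforming mesh.

Element residual (`Mesh.exists_residual_bound`): this is Verfürth's bubble technique. Put `p = Qf -
div div σh`, a polynomial of degree at most `r` on `T`, and `v = b²p` with `b` the cubic bubble.
Both `v` and `∇v` vanish on `∂T`, so the zero extension of `v` is an admissible test function for
the plate equation, and integrating by parts twice on `T` leaves no boundary terms: `∫ p v = ∫ (Qf -
f) v + ∫ (σ - σh) : ∇²v`. On the reference triangle all norms on polynomials of degree at most `r`
are equivalent (`exists_refInt_le`), so `∫ p v` controls `∫ p²`, `∫ v²` and, scaled by the fourth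
power of the barycentric gradients, `∫ |∇²v|²` (`exists_bubble`). Shape regularity bounds these
gradients by `κ / h_T` (`IsTriangle.exists_baryGrad_bound`). Young's inequality then absorbs the `v`
terms into `∫ p v`. -/

/-! ### Triangles and their affine parametrization -/

/-- The determinant of two vectors of the plane. -/
def det2 (p q : E2) : ℝ := p 0 * q 1 - p 1 * q 0

/-- The reference triangle. -/
def refTri : Set (ℝ × ℝ) := {s | 0 ≤ s.1 ∧ 0 ≤ s.2 ∧ s.1 + s.2 ≤ 1}

/-- The affine map from the reference triangle to the triangle `a b c`. -/
noncomputable def triPt (a b c : E2) (s : ℝ × ℝ) : E2 := a + s.1 • (b - a) + s.2 • (c - a)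

theorem ext_E2 {x y : E2} (h0 : x 0 = y 0) (h1 : x 1 = y 1) : x = y := by
  ext i; fin_cases i <;> assumption

theorem convexHull_eq_image_refTri (a b c : E2) :
    convexHull ℝ ({a, b, c} : Set E2) = triPt a b c '' refTri := by
  apply Set.Subset.antisymm
  · apply convexHull_min
    · rintro x (rfl | rfl | rfl)
      · exact ⟨(0, 0), by simp [refTri], by simp [triPt]⟩
      · exact ⟨(1, 0), by simp [refTri], by simp [triPt]⟩
      · exact ⟨(0, 1), by simp [refTri], by simp [triPt]⟩
    · rintro _ ⟨s, hs, rfl⟩ _ ⟨t, ht, rfl⟩ x y hx hy hxy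
      obtain ⟨h1, h2, h3⟩ := hs
      obtain ⟨k1, k2, k3⟩ := ht
      refine ⟨(x * s.1 + y * t.1, x * s.2 + y * t.2), ⟨by positivity, by positivity, ?_⟩, ?_⟩
      · show x * s.1 + y * t.1 + (x * s.2 + y * t.2) ≤ 1
        nlinarith
      · obtain rfl : x = 1 - y := by linarith
        apply ext_E2 <;> simp [triPt] <;> ring
  · rintro _ ⟨s, ⟨h1, h2, h3⟩, rfl⟩
    have hc := convex_convexHull ℝ ({a, b, c} : Set E2)
    have ha : a ∈ convexHull ℝ ({a, b, c} : Set E2) := subset_convexHull _ _ (by simp)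
    have hb : b ∈ convexHull ℝ ({a, b, c} : Set E2) := subset_convexHull _ _ (by simp)
    have hcc : c ∈ convexHull ℝ ({a, b, c} : Set E2) := subset_convexHull _ _ (by simp)
    have := hc.sum_mem (t := Finset.univ) (w := ![1 - s.1 - s.2, s.1, s.2]) (z := ![a, b, c])
      (by intro i _; fin_cases i <;> simp <;> linarith)
      (by simp [Fin.sum_univ_three]; ring) (by intro i _; fin_cases i <;> simp <;> assumption)
    convert this using 1
    simp only [Fin.sum_univ_three, triPt]
    apply ext_E2 <;> simp <;> ring

theorem hull_subset_of_mem {s : Finset E2} {x : E2} (h : x ∈ s) : x ∈ hull s :=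
  subset_convexHull _ _ h

theorem isCompact_hull (s : Finset E2) : IsCompact (hull s) :=
  s.finite_toSet.isCompact_convexHull ℝ

theorem measurableSet_hull (s : Finset E2) : MeasurableSet (hull s) :=
  (isCompact_hull s).isClosed.measurableSet

theorem isCompact_refTri : IsCompact refTri := by
  apply Metric.isCompact_of_isClosed_isBounded
  · exact (isClosed_le continuous_const continuous_fst).inter
      ((isClosed_le continuous_const continuous_snd).inter
        (isClosed_le (continuous_fst.add continuous_snd) continuous_const))
  · apply (Metric.isBounded_Icc (0 : ℝ × ℝ) (1, 1)).subset
    rintro s ⟨h1, h2, h3⟩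
    exact ⟨⟨h1, h2⟩, ⟨by show s.1 ≤ 1; linarith, by show s.2 ≤ 1; linarith⟩⟩

theorem continuous_triPt (a b c : E2) : Continuous (triPt a b c) := by
  unfold triPt; fun_prop

/-- Change of variables to the reference triangle. -/
theorem integral_triangle {a b c : E2} (h : det2 (b - a) (c - a) ≠ 0) (g : E2 → ℝ) :
    ∫ x in convexHull ℝ ({a, b, c} : Set E2), g x =
      |det2 (b - a) (c - a)| * ∫ s in refTri, g (triPt a b c s) := by
  -- The Jacobian formula is applied to a self-map of `ℝ × ℝ`: the measure-preserving identification
  -- `m` turns the affine parametrization into `F`.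
  set m : (ℝ × ℝ) ≃ᵐ E2 :=
    (MeasurableEquiv.finTwoArrow (α := ℝ)).symm.trans (MeasurableEquiv.toLp 2 (Fin 2 → ℝ)) with hm
  have hmp : MeasurePreserving m :=
    (PiLp.volume_preserving_toLp (Fin 2)).comp ((volume_preserving_finTwoArrow ℝ).symm _)
  have hm0 : ∀ s, m s 0 = s.1 := fun s => rfl
  have hm1 : ∀ s, m s 1 = s.2 := fun s => rfl
  set F : ℝ × ℝ → ℝ × ℝ := fun s => ((triPt a b c s) 0, (triPt a b c s) 1) with hF
  have hmF : ∀ s, m (F s) = triPt a b c s := fun s => ext_E2 (hm0 _) (hm1 _)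
  rw [convexHull_eq_image_refTri, ← hmp.setIntegral_preimage_emb m.measurableEmbedding]
  have himg : m ⁻¹' (triPt a b c '' refTri) = F '' refTri := by
    ext s
    constructor
    · rintro ⟨t, ht, hts⟩
      refine ⟨t, ht, m.injective ?_⟩
      rw [hmF, hts]
    · rintro ⟨t, ht, rfl⟩
      exact ⟨t, ht, (hmF t).symm⟩
  rw [himg]
  set L : ℝ × ℝ →L[ℝ] ℝ × ℝ := (Matrix.toLin (.finTwoProd ℝ) (.finTwoProd ℝ)
    !![(b - a) 0, (c - a) 0; (b - a) 1, (c - a) 1]).toContinuousLinearMap with hL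
  have hdet : L.det = det2 (b - a) (c - a) := by
    simp only [hL, LinearMap.det_toContinuousLinearMap, LinearMap.det_toLin,
      Matrix.det_fin_two_of, det2]
    ring
  have hder : ∀ s, HasFDerivAt F L s := by
    intro s
    have hFL : F = fun s => (a 0, a 1) + L s := by
      funext s
      simp [hF, hL, triPt, Matrix.toLin_finTwoProd_toContinuousLinearMap]
      constructor <;> ring
    rw [hFL]
    exact L.hasFDerivAt.const_add _
  have hinj : Set.InjOn F refTri := by
    intro s _ t _ hst
    simp only [hF, triPt, Prod.mk.injEq] at hst
    obtain ⟨h0, h1⟩ := hst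
    simp only [PiLp.add_apply, PiLp.smul_apply, smul_eq_mul] at h0 h1
    -- Cramer's rule recovers the parameters from the point.
    have e1 : (s.1 - t.1) * det2 (b - a) (c - a) = 0 := by
      unfold det2; linear_combination (c - a) 1 * h0 - (c - a) 0 * h1
    have e2 : (s.2 - t.2) * det2 (b - a) (c - a) = 0 := by
      unfold det2; linear_combination (b - a) 0 * h1 - (b - a) 1 * h0
    exact Prod.ext (by have := (mul_eq_zero.1 e1).resolve_right h; linarith)
      (by have := (mul_eq_zero.1 e2).resolve_right h; linarith)
  rw [integral_image_eq_integral_abs_det_fderiv_smul volume isCompact_refTri.measurableSet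
    (fun s _ => (hder s).hasFDerivWithinAt) hinj]
  simp_rw [hdet, hmF, smul_eq_mul]
  rw [integral_const_mul]

/-- Fubini on the reference triangle. -/
theorem integral_refTri (g : ℝ × ℝ → ℝ) (hg : Continuous g) :
    ∫ s in refTri, g s = ∫ t in (0:ℝ)..1, ∫ s in (0:ℝ)..(1 - t), g (s, t) := by
  rw [← integral_indicator isCompact_refTri.measurableSet]
  rw [Measure.volume_eq_prod, integral_prod_symm]
  · rw [intervalIntegral.integral_of_le zero_le_one, ← integral_Icc_eq_integral_Ioc,
      ← integral_indicator measurableSet_Icc]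
    congr 1
    funext t
    by_cases ht : t ∈ Set.Icc (0:ℝ) 1
    · rw [Set.indicator_of_mem ht, intervalIntegral.integral_of_le (by linarith [ht.2]),
        ← integral_Icc_eq_integral_Ioc, ← integral_indicator measurableSet_Icc]
      congr 1
      funext s
      by_cases hs : s ∈ Set.Icc (0:ℝ) (1 - t)
      · rw [Set.indicator_of_mem hs, Set.indicator_of_mem]
        exact ⟨hs.1, ht.1, by have := hs.2; show s + t ≤ 1; linarith⟩
      · rw [Set.indicator_of_notMem hs, Set.indicator_of_notMem]
        rintro ⟨h1, h2, h3⟩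
        exact hs ⟨h1, by simp only at h3; linarith⟩
    · rw [Set.indicator_of_notMem ht]
      have : ∀ s, refTri.indicator g (s, t) = 0 := by
        intro s
        apply Set.indicator_of_notMem
        rintro ⟨h1, h2, h3⟩
        exact ht ⟨h2, by simp only at h1 h3; linarith⟩
      simp [this]
  · rw [← Measure.volume_eq_prod]
    rw [integrable_indicator_iff isCompact_refTri.measurableSet]
    exact hg.continuousOn.integrableOn_compact isCompact_refTri

/-- The divergence theorem on a triangle, in the direction of the side `b - a`. -/
theorem integral_fderiv_triangle {a b c : E2} (h : det2 (b - a) (c - a) ≠ 0) (g : E2 → ℝ)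
    (hg : ContDiff ℝ 1 g) :
    ∫ x in convexHull ℝ ({a, b, c} : Set E2), fderiv ℝ g x (b - a) =
      |det2 (b - a) (c - a)| *
        ((∫ t in (0:ℝ)..1, g (b + t • (c - b))) - ∫ t in (0:ℝ)..1, g (a + t • (c - a))) := by
  have hc : Continuous fun x => fderiv ℝ g x (b - a) :=
    (hg.continuous_fderiv one_ne_zero).clm_apply continuous_const
  rw [integral_triangle h,
    integral_refTri (fun s => fderiv ℝ g (triPt a b c s) (b - a)) (hc.comp (continuous_triPt a b c))]
  congr 1
  rw [← intervalIntegral.integral_sub]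
  · apply intervalIntegral.integral_congr
    intro t _
    simp only
    -- On each line parallel to `b - a` the integrand is the derivative in `s`. The ends `s = 0` and
    -- `s = 1 - t` lie on the sides `ac` and `bc`.
    have hd : ∀ s, HasDerivAt (fun s : ℝ => g (triPt a b c (s, t)))
        (fderiv ℝ g (triPt a b c (s, t)) (b - a)) s := by
      intro s
      have h1 : HasDerivAt (fun s : ℝ => triPt a b c (s, t)) (b - a) s := by
        unfold triPt
        simpa using (((hasDerivAt_id s).smul_const (b - a)).const_add a).add_const (t • (c - a))
      exact ((hg.differentiable one_ne_zero _).hasFDerivAt.comp_hasDerivAt s h1)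
    rw [intervalIntegral.integral_eq_sub_of_hasDerivAt (fun s _ => hd s)]
    · congr 2
      · apply ext_E2 <;> simp [triPt] <;> ring
      · apply ext_E2 <;> simp [triPt]
    · apply Continuous.intervalIntegrable
      exact hc.comp ((continuous_triPt a b c).comp (by fun_prop))
  · apply Continuous.intervalIntegrable
    exact hg.continuous.comp (by fun_prop)
  · apply Continuous.intervalIntegrable
    exact hg.continuous.comp (by fun_prop)

/-- The mean value over the segment `a b`. -/
noncomputable def segMean (g : E2 → ℝ) (a b : E2) : ℝ := ∫ t in (0:ℝ)..1, g (a + t • (b - a))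

theorem segMean_comm (g : E2 → ℝ) (a b : E2) : segMean g a b = segMean g b a := by
  unfold segMean
  have := intervalIntegral.integral_comp_sub_left (a := 0) (b := 1)
    (fun t : ℝ => g (a + t • (b - a))) 1
  simp only [sub_self, sub_zero] at this
  rw [← this]
  apply intervalIntegral.integral_congr
  intro t _
  simp only
  congr 1
  apply ext_E2 <;> simp <;> ring

/-- Integration with respect to arc length on a segment. -/
theorem integral_segment_hausdorff {a b : E2} (hab : a ≠ b) (g : E2 → ℝ) :
    ∫ x, g x ∂((Measure.hausdorffMeasure 1).restrict (segment ℝ a b)) =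
      ‖b - a‖ * segMean g a b := by
  have hn : 0 < ‖b - a‖ := norm_pos_iff.2 (sub_ne_zero.2 hab.symm)
  -- The unit-speed parametrization is an isometry, so it carries Lebesgue measure, which is the
  -- Hausdorff measure of `ℝ`, to arc length.
  set i : ℝ → E2 := fun t => a + t • (‖b - a‖⁻¹ • (b - a)) with hi
  have hiso : Isometry i := by
    apply Isometry.of_dist_eq
    intro s t
    rw [hi, dist_add_left, dist_eq_norm, ← sub_smul, norm_smul, norm_smul, norm_inv, norm_norm,
      inv_mul_cancel₀ hn.ne', mul_one, dist_eq_norm]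
  have himg : segment ℝ a b = i '' Set.Icc 0 ‖b - a‖ := by
    rw [segment_eq_image']
    ext x
    constructor
    · rintro ⟨t, ht, rfl⟩
      refine ⟨t * ‖b - a‖, ⟨by have := ht.1; positivity, by nlinarith [ht.2]⟩, ?_⟩
      simp only [hi, smul_smul]
      congr 2; field_simp
    · rintro ⟨t, ht, rfl⟩
      refine ⟨t * ‖b - a‖⁻¹, ⟨by have := ht.1; positivity, ?_⟩, ?_⟩
      · rw [← div_eq_mul_inv, div_le_one hn]; exact ht.2
      · simp only [hi, smul_smul]
  have hemb := hiso.isClosedEmbedding.measurableEmbedding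
  have hmap := hiso.map_hausdorffMeasure (d := 1) (Or.inl zero_le_one)
  have hrange : MeasurableSet (Set.range i) := hiso.isClosedEmbedding.isClosed_range.measurableSet
  have hres : (Measure.hausdorffMeasure 1).restrict (segment ℝ a b) =
      Measure.map i ((volume : Measure ℝ).restrict (Set.Icc 0 ‖b - a‖)) := by
    rw [← hausdorffMeasure_real, himg]
    have hs : i '' Set.Icc 0 ‖b - a‖ = i '' Set.Icc 0 ‖b - a‖ ∩ Set.range i := by
      rw [Set.inter_eq_left.2 (Set.image_subset_range _ _)]
    rw [hs, ← Measure.restrict_restrict' hrange, ← hmap, hemb.restrict_map,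
      Set.preimage_image_eq _ hemb.injective]
  rw [hres, hemb.integral_map, integral_Icc_eq_integral_Ioc,
    ← intervalIntegral.integral_of_le hn.le, segMean]
  have := intervalIntegral.mul_integral_comp_mul_left (a := 0) (b := 1)
    (f := fun t : ℝ => g (i t)) (c := ‖b - a‖)
  simp only [mul_zero, mul_one] at this
  rw [← this]
  congr 1
  apply intervalIntegral.integral_congr
  intro t _
  simp only [hi, smul_smul]
  congr 3; field_simp

/-! ### Vertices and edges of a triangle -/

/-- `T` is a nondegenerate triangle with the vertices `a`, `b`, `c`. -/
structure IsTriangle (T : Finset E2) (a b c : E2) : Prop where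
  coe_eq : (T : Set E2) = {a, b, c}
  det_ne : det2 (b - a) (c - a) ≠ 0

namespace IsTriangle

variable {T : Finset E2} {a b c : E2}

/-- A triangle is an unordered set of vertices. `swap` and `rotate` generate all its labellings, so
a fact proved for one edge is available for the others. -/
theorem swap (h : IsTriangle T a b c) : IsTriangle T a c b where
  coe_eq := by rw [h.coe_eq, Set.pair_comm]
  det_ne := by
    have := h.det_ne
    contrapose! this
    unfold det2 at *; linarith

theorem rotate (h : IsTriangle T a b c) : IsTriangle T b c a where
  coe_eq := by rw [h.coe_eq]; ext x; simp; tauto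
  det_ne := by
    have := h.det_ne
    contrapose! this
    unfold det2 at *; simp at *; linarith

theorem hull_eq (h : IsTriangle T a b c) : hull T = convexHull ℝ {a, b, c} := by
  rw [hull, h.coe_eq]

theorem ne_fst (h : IsTriangle T a b c) : a ≠ b := by
  rintro rfl; exact h.det_ne (by simp [det2])

theorem ne_snd (h : IsTriangle T a b c) : b ≠ c := h.rotate.ne_fst

theorem ne_trd (h : IsTriangle T a b c) : a ≠ c := h.swap.ne_fst

open scoped Classical in
theorem eq (h : IsTriangle T a b c) : T = {a, b, c} := by
  rw [← Finset.coe_inj, h.coe_eq]; simp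

open scoped Classical in
theorem triEdges_eq (h : IsTriangle T a b c) :
    triEdges T = {({a, b} : Finset E2), {a, c}, {b, c}} := by
  have h1 := h.ne_fst
  have h2 := h.ne_snd
  have h3 := h.ne_trd
  rw [triEdges, h.eq]
  ext e
  rw [Finset.mem_powersetCard]
  constructor
  · rintro ⟨hs, hc⟩
    have h3' : ({a, b, c} : Finset E2).card = 3 := by
      rw [Finset.card_eq_three]; exact ⟨a, b, c, h1, h3, h2, rfl⟩
    obtain ⟨x, hx⟩ : ∃ x, ({a, b, c} : Finset E2) \ e = {x} := by
      rw [← Finset.card_eq_one, Finset.card_sdiff_of_subset hs, h3', hc]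
    have he : e = ({a, b, c} : Finset E2) \ {x} := by
      rw [← hx, Finset.sdiff_sdiff_eq_self hs]
    have hxm : x ∈ ({a, b, c} : Finset E2) := by
      have : x ∈ ({a, b, c} : Finset E2) \ e := by rw [hx]; simp
      exact (Finset.mem_sdiff.1 this).1
    simp only [Finset.mem_insert, Finset.mem_singleton] at hxm ⊢
    rcases hxm with rfl | rfl | rfl
    · right; right; rw [he]; ext y; simp; grind
    · right; left; rw [he]; ext y; simp; grind
    · left; rw [he]; ext y; simp; grind
  · intro he
    simp only [Finset.mem_insert, Finset.mem_singleton] at he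
    rcases he with rfl | rfl | rfl
    · exact ⟨by intro y; simp; tauto, Finset.card_pair h1⟩
    · exact ⟨by intro y; simp; tauto, Finset.card_pair h3⟩
    · exact ⟨by intro y; simp; tauto, Finset.card_pair h2⟩

open scoped Classical in
theorem sum_triEdges (h : IsTriangle T a b c) (F : Finset E2 → ℝ) :
    ∑ e ∈ triEdges T, F e = F {a, b} + F {a, c} + F {b, c} := by
  have h1 := h.ne_fst
  have h2 := h.ne_snd
  have h3 := h.ne_trd
  have n1 : ({a, b} : Finset E2) ≠ {a, c} := by
    intro he
    have : b ∈ ({a, c} : Finset E2) := by rw [← he]; simp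
    simp at this; grind
  have n2 : ({a, b} : Finset E2) ≠ {b, c} := by
    intro he
    have : a ∈ ({b, c} : Finset E2) := by rw [← he]; simp
    simp at this; grind
  have n3 : ({a, c} : Finset E2) ≠ {b, c} := by
    intro he
    have : a ∈ ({b, c} : Finset E2) := by rw [← he]; simp
    simp at this; grind
  rw [h.triEdges_eq, Finset.sum_insert (by simp [n1, n2]), Finset.sum_insert (by simp [n3]),
    Finset.sum_singleton]
  ring

end IsTriangle

theorem det2_ne_zero_of_affineIndependent {a b c : E2} (h : AffineIndependent ℝ ![a, b, c]) :
    det2 (b - a) (c - a) ≠ 0 := by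
  rw [affineIndependent_iff] at h
  have key : ∀ s t : ℝ, s • (b - a) + t • (c - a) = 0 → s = 0 ∧ t = 0 := by
    intro s t hst
    have := h Finset.univ ![-s - t, s, t] (by simp [Fin.sum_univ_three]; ring) (by
      simp only [Fin.sum_univ_three, Matrix.cons_val]
      rw [← hst]
      apply ext_E2 <;> simp <;> ring)
    exact ⟨by simpa using this 1 (Finset.mem_univ _), by simpa using this 2 (Finset.mem_univ _)⟩
  intro hdet
  unfold det2 at hdet
  -- If the determinant vanishes, the coordinates of the two sides are coefficients of a linear
  -- relation between them; independence forces `b - a = 0`, itself a relation.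
  obtain ⟨-, h0⟩ := key ((c - a) 0) (-(b - a) 0) (by
    apply ext_E2 <;> simp at hdet ⊢ <;> linarith)
  obtain ⟨-, h1⟩ := key ((c - a) 1) (-(b - a) 1) (by
    apply ext_E2 <;> simp at hdet ⊢ <;> linarith)
  have hz : b - a = 0 := ext_E2 (neg_eq_zero.1 h0) (neg_eq_zero.1 h1)
  have := (key 1 0 (by simp [hz])).1
  norm_num at this

theorem exists_isTriangle {T : Finset E2} (h3 : T.card = 3)
    (hT : AffineIndependent ℝ ((↑) : T → E2)) : ∃ a b c, IsTriangle T a b c := by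
  classical
  obtain ⟨a, b, c, hab, hac, hbc, rfl⟩ := Finset.card_eq_three.1 h3
  refine ⟨a, b, c, by simp, det2_ne_zero_of_affineIndependent ?_⟩
  let f : Fin 3 ↪ ({a, b, c} : Finset E2) :=
    ⟨![⟨a, by simp⟩, ⟨b, by simp⟩, ⟨c, by simp⟩], by
      intro i j hij; fin_cases i <;> fin_cases j <;> simp_all⟩
  have := hT.comp_embedding f
  convert this using 1
  funext i; fin_cases i <;> rfl

theorem Mesh.exists_isTriangle {Ω : Set E2} (K : Mesh Ω) {T : Finset E2} (hT : T ∈ K.tri) :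
    ∃ a b c, IsTriangle T a b c :=
  _root_.exists_isTriangle (K.card_tri T hT) (K.indep T hT)

/-- An edge can be brought to the first position. -/
theorem IsTriangle.exists_of_mem {T e : Finset E2} {a b c : E2} (h : IsTriangle T a b c)
    (he : e ∈ triEdges T) : ∃ o p q, IsTriangle T o p q ∧ (e : Set E2) = {p, q} := by
  classical
  rw [h.triEdges_eq] at he
  simp only [Finset.mem_insert, Finset.mem_singleton] at he
  rcases he with rfl | rfl | rfl
  · exact ⟨c, a, b, h.rotate.rotate, by simp⟩
  · exact ⟨b, a, c, h.rotate.swap, by simp⟩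
  · exact ⟨a, b, c, h, by simp⟩

theorem hull_pair {e : Finset E2} {p q : E2} (he : (e : Set E2) = {p, q}) :
    hull e = segment ℝ p q := by
  rw [hull, he, convexHull_pair]

theorem integral_edgeMeasure {e : Finset E2} {p q : E2} (he : (e : Set E2) = {p, q})
    (hpq : p ≠ q) (g : E2 → ℝ) : ∫ x, g x ∂(edgeMeasure e) = ‖q - p‖ * segMean g p q := by
  rw [edgeMeasure, hull_pair he, integral_segment_hausdorff hpq]

theorem inner_E2 (x y : E2) : inner ℝ x y = x 0 * y 0 + x 1 * y 1 := by
  simp [PiLp.inner_apply, Fin.sum_univ_two, mul_comm]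

theorem norm_sq_E2 (x : E2) : ‖x‖ ^ 2 = x 0 ^ 2 + x 1 ^ 2 := by
  rw [EuclideanSpace.norm_sq_eq]; simp [Fin.sum_univ_two]

/-! ### The outward normal -/

/-- The normal is selected by `Classical.epsilon`, so its properties need a witness: the side `q -
p` turned by a right angle and normalized, its sign corrected by the orientation `D / |D|` of the
triangle. -/
theorem outNormal_spec {T e : Finset E2} {o p q : E2} (hT : IsTriangle T o p q)
    (he : (e : Set E2) = {p, q}) :
    ‖outNormal T e‖ = 1 ∧ inner ℝ (outNormal T e) (q - p) = 0 ∧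
      0 < inner ℝ (outNormal T e) (p - o) := by
  have hmem : ∀ x, x ∈ e ↔ x = p ∨ x = q := by
    intro x; rw [← Finset.mem_coe, he]; simp
  have hmemT : ∀ x, x ∈ T ↔ x = o ∨ x = p ∨ x = q := by
    intro x; rw [← Finset.mem_coe, hT.coe_eq]; simp
  have hex : ∃ n : E2, ‖n‖ = 1 ∧ (∀ a ∈ e, ∀ b ∈ e, inner ℝ n (b - a) = 0) ∧
      ∀ a ∈ e, ∀ c ∈ T, c ∉ e → inner ℝ n (c - a) < 0 := by
    set D := det2 (p - o) (q - o) with hD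
    have hD0 : D ≠ 0 := hT.det_ne
    set n0 : E2 := !₂[(q - p) 1, -(q - p) 0] with hn0
    have hnn : 0 < ‖n0‖ := by
      rw [norm_pos_iff]
      intro hz
      have e0 : n0 0 = 0 := by rw [hz]; rfl
      have e1 : n0 1 = 0 := by rw [hz]; rfl
      simp [hn0] at e0 e1
      exact hT.ne_snd (ext_E2 (by linarith) (by linarith))
    have hin : ∀ x : E2, inner ℝ ((D / (|D| * ‖n0‖)) • n0) x =
        D / (|D| * ‖n0‖) * ((q - p) 1 * x 0 - (q - p) 0 * x 1) := by
      intro x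
      rw [inner_smul_left, inner_E2]
      simp [hn0]; ring_nf; simp
    have hpos : 0 < |D| := abs_pos.2 hD0
    have hneg : D / (|D| * ‖n0‖) * (-D) < 0 := by
      have : D / (|D| * ‖n0‖) * (-D) = -(D ^ 2 / (|D| * ‖n0‖)) := by ring
      rw [this]; have : 0 < D ^ 2 := by positivity
      rw [neg_lt_zero]; positivity
    refine ⟨(D / (|D| * ‖n0‖)) • n0, ?_, ?_, ?_⟩
    · rw [norm_smul, norm_div, norm_mul, norm_norm, Real.norm_eq_abs, Real.norm_eq_abs, abs_abs]
      field_simp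
    · intro x hx y hy
      rw [hin]
      rw [hmem] at hx hy
      rcases hx with rfl | rfl <;> rcases hy with rfl | rfl <;> simp <;> right <;> ring
    · intro x hx y hy hye
      rw [hmemT] at hy
      rw [hmem] at hx hye
      obtain rfl : y = o := by tauto
      rw [hin]
      have : (q - p) 1 * (y - x) 0 - (q - p) 0 * (y - x) 1 = -D := by
        rcases hx with rfl | rfl <;> simp [hD, det2] <;> ring
      rw [this]; exact hneg
  have hs := Classical.epsilon_spec hex
  change ‖outNormal T e‖ = 1 ∧ (∀ a ∈ e, ∀ b ∈ e, inner ℝ (outNormal T e) (b - a) = 0) ∧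
      ∀ a ∈ e, ∀ c ∈ T, c ∉ e → inner ℝ (outNormal T e) (c - a) < 0 at hs
  refine ⟨hs.1, hs.2.1 p ((hmem p).2 (Or.inl rfl)) q ((hmem q).2 (Or.inr rfl)), ?_⟩
  have := hs.2.2 p ((hmem p).2 (Or.inl rfl)) o ((hmemT o).2 (Or.inl rfl)) (by
    rw [hmem]; exact not_or.2 ⟨hT.ne_fst, hT.ne_trd⟩)
  rw [← neg_sub, inner_neg_right] at this
  linarith

/-- Length times normal is the rotated side up to orientation. Multiplying by the determinant
removes the sign function, which makes the edge terms of the divergence theorem algebraic. In the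
frame of `n`, the side is `s` times the rotated normal, and the determinant is `s * k` with `k > 0`.
-/
theorem outNormal_mul_norm {T e : Finset E2} {o p q : E2} (hT : IsTriangle T o p q)
    (he : (e : Set E2) = {p, q}) :
    outNormal T e 0 * ‖q - p‖ * det2 (p - o) (q - o) = |det2 (p - o) (q - o)| * (q - p) 1 ∧
    outNormal T e 1 * ‖q - p‖ * det2 (p - o) (q - o) = -(|det2 (p - o) (q - o)| * (q - p) 0) := by
  obtain ⟨h1, h2, h3⟩ := outNormal_spec hT he
  set n := outNormal T e
  have h1' : n 0 ^ 2 + n 1 ^ 2 = 1 := by rw [← norm_sq_E2, h1]; norm_num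
  rw [inner_E2] at h2 h3
  set s := det2 n (q - p) with hs
  set k := n 0 * (p - o) 0 + n 1 * (p - o) 1 with hk
  have w0 : (q - p) 0 = -s * n 1 := by
    rw [hs, det2]; linear_combination (-(q - p) 0) * h1' + n 0 * h2
  have w1 : (q - p) 1 = s * n 0 := by
    rw [hs, det2]; linear_combination (-(q - p) 1) * h1' + n 1 * h2
  have hD : det2 (p - o) (q - o) = s * k := by
    have : det2 (p - o) (q - o) = det2 (p - o) (q - p) := by simp [det2]; ring
    rw [this, det2, w0, w1, hk]; ring
  have hnorm : ‖q - p‖ = |s| := by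
    rw [← abs_of_nonneg (norm_nonneg (q - p)), ← sq_eq_sq_iff_abs_eq_abs, norm_sq_E2, w0, w1]
    linear_combination s ^ 2 * h1'
  rw [hnorm, hD, abs_mul, abs_of_pos h3, w0, w1]
  constructor <;> ring

/-- The divergence theorem on a triangle. -/
theorem integral_partialD_triangle {T : Finset E2} {a b c : E2} (hT : IsTriangle T a b c)
    {g : E2 → ℝ} (hg : ContDiff ℝ 1 g) (i : Fin 2) :
    ∫ x in hull T, partialD i g x =
      ∑ e ∈ triEdges T, outNormal T e i * ∫ x, g x ∂(edgeMeasure e) := by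
  classical
  rw [hT.sum_triEdges]
  have hab := integral_fderiv_triangle hT.det_ne g hg
  have hac := integral_fderiv_triangle hT.swap.det_ne g hg
  rw [← hT.swap.hull_eq] at hac
  rw [← hT.hull_eq] at hab
  change _ = _ * (segMean g b c - segMean g a c) at hab
  change _ = _ * (segMean g c b - segMean g a b) at hac
  rw [segMean_comm g c b] at hac
  set D := det2 (b - a) (c - a) with hD
  have hD0 : D ≠ 0 := hT.det_ne
  have hDs : det2 (c - a) (b - a) = -D := by rw [hD]; unfold det2; ring
  rw [hDs, abs_neg] at hac
  have e1 := integral_edgeMeasure (e := {a, b}) (by simp) hT.ne_fst g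
  have e2 := integral_edgeMeasure (e := {a, c}) (by simp) hT.ne_trd g
  have e3 := integral_edgeMeasure (e := {b, c}) (by simp) hT.ne_snd g
  rw [e1, e2, e3]
  have n1 := outNormal_mul_norm (e := {a, b}) hT.rotate.rotate (by simp)
  have n2 := outNormal_mul_norm (e := {a, c}) hT.rotate.swap (by simp)
  have n3 := outNormal_mul_norm (e := {b, c}) hT (by simp)
  have d1 : det2 (a - c) (b - c) = D := by rw [hD]; simp [det2]; ring
  have d2 : det2 (a - b) (c - b) = -D := by rw [hD]; simp [det2]; ring
  rw [d1] at n1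
  rw [d2, abs_neg] at n2
  have hcont : ∀ v, IntegrableOn (fun x => fderiv ℝ g x v) (hull T) := fun v =>
    ((hg.continuous_fderiv one_ne_zero).clm_apply
      continuous_const).continuousOn.integrableOn_compact (isCompact_hull T)
  -- A coordinate direction is a combination of two sides, and the theorem is known in both side
  -- directions; the coefficients supplied below come from Cramer's rule.
  have key : ∀ α β : ℝ, EuclideanSpace.single i 1 = α • (b - a) + β • (c - a) →
      ∫ x in hull T, partialD i g x = α * (|D| * (segMean g b c - segMean g a c)) +
        β * (|D| * (segMean g b c - segMean g a b)) := by
    intro α β hαβ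
    rw [← hab, ← hac, ← integral_const_mul, ← integral_const_mul,
      ← integral_add ((hcont _).const_mul _) ((hcont _).const_mul _)]
    unfold partialD
    rw [hαβ]
    simp
  have cancel : ∀ x y : ℝ, x * D = y * D → x = y := fun x y h => mul_right_cancel₀ hD0 h
  fin_cases i
  · rw [key ((c - a) 1 / D) (-(b - a) 1 / D) ?_]
    · apply cancel
      simp only [Fin.zero_eta]
      have n1 := n1.1
      have n2 := n2.1
      have n3 := n3.1
      field_simp
      simp only [PiLp.sub_apply] at *
      linear_combination (-segMean g a b) * n1 + (segMean g a c) * n2 - (segMean g b c) * n3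
    · apply ext_E2 <;> simp <;> field_simp <;> (simp [hD, det2]; try ring)
  · rw [key (-(c - a) 0 / D) ((b - a) 0 / D) ?_]
    · apply cancel
      simp only [Fin.mk_one]
      have n1 := n1.2
      have n2 := n2.2
      have n3 := n3.2
      field_simp
      simp only [PiLp.sub_apply] at *
      linear_combination (-segMean g a b) * n1 + (segMean g a c) * n2 - (segMean g b c) * n3
    · apply ext_E2 <;> simp <;> field_simp <;> (simp [hD, det2]; try ring)

/-! ### Calculus of polynomials -/

@[simp] theorem pval_add (p q : Poly2) (x : E2) : pval (p + q) x = pval p x + pval q x := by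
  simp [pval]

@[simp] theorem pval_sub (p q : Poly2) (x : E2) : pval (p - q) x = pval p x - pval q x := by
  simp [pval]

@[simp] theorem pval_mul (p q : Poly2) (x : E2) : pval (p * q) x = pval p x * pval q x := by
  simp [pval]

@[simp] theorem pval_C (t : ℝ) (x : E2) : pval (MvPolynomial.C t) x = t := by
  simp [pval]

@[simp] theorem pval_X (i : Fin 2) (x : E2) : pval (MvPolynomial.X i) x = x i := by
  simp [pval]

theorem pval_sum {ι : Type*} (s : Finset ι) (p : ι → Poly2) (x : E2) :
    pval (∑ i ∈ s, p i) x = ∑ i ∈ s, pval (p i) x := by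
  simp [pval]

theorem contDiff_pval (p : Poly2) : ContDiff ℝ ∞ (pval p) := by
  induction p using MvPolynomial.induction_on with
  | C t =>
    have : pval (MvPolynomial.C t) = fun _ => t := by funext x; simp
    rw [this]; exact contDiff_const
  | add p q hp hq =>
    have : pval (p + q) = fun x => pval p x + pval q x := by funext x; simp
    rw [this]; exact hp.add hq
  | mul_X p i hp =>
    have : pval (p * MvPolynomial.X i) = fun x => pval p x * x i := by funext x; simp
    rw [this]
    exact hp.mul (EuclideanSpace.proj (𝕜 := ℝ) i : E2 →L[ℝ] ℝ).contDiff

theorem continuous_pval (p : Poly2) : Continuous (pval p) := (contDiff_pval p).continuous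

theorem differentiable_pval (p : Poly2) : Differentiable ℝ (pval p) :=
  (contDiff_pval p).differentiable (by simp)

theorem partialD_mul {f g : E2 → ℝ} {x : E2} (hf : DifferentiableAt ℝ f x)
    (hg : DifferentiableAt ℝ g x) (i : Fin 2) :
    partialD i (fun y => f y * g y) x = partialD i f x * g x + f x * partialD i g x := by
  unfold partialD
  rw [fderiv_fun_mul hf hg]
  simp; ring

theorem partialD_pval (p : Poly2) (i : Fin 2) (x : E2) :
    partialD i (pval p) x = pval (MvPolynomial.pderiv i p) x := by
  induction p using MvPolynomial.induction_on with
  | C t =>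
    have : pval (MvPolynomial.C t) = fun _ => t := by funext x; simp
    rw [this]; simp [partialD, pval]
  | add p q hp hq =>
    have : pval (p + q) = fun x => pval p x + pval q x := by funext x; simp
    rw [this, map_add, pval_add, ← hp, ← hq]
    unfold partialD
    rw [fderiv_fun_add (differentiable_pval p x) (differentiable_pval q x)]
    simp
  | mul_X p j hp =>
    have : pval (p * MvPolynomial.X j) = fun x => pval p x * x j := by funext x; simp
    have hX : HasFDerivAt (fun y : E2 => y j) (EuclideanSpace.proj (𝕜 := ℝ) j : E2 →L[ℝ] ℝ) x :=
      (EuclideanSpace.proj (𝕜 := ℝ) j : E2 →L[ℝ] ℝ).hasFDerivAt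
    rw [this, partialD_mul (differentiable_pval p x) hX.differentiableAt, hp]
    have hj : partialD i (fun y : E2 => y j) x = if j = i then 1 else 0 := by
      unfold partialD
      rw [hX.fderiv]
      simp
    rw [hj, Derivation.leibniz, MvPolynomial.pderiv_X]
    simp only [smul_eq_mul, pval_add, pval_mul, pval_X]
    by_cases hji : j = i
    · subst hji; simp [pval]; ring
    · simp [pval, hji]; ring

theorem continuous_partialD {φ : E2 → ℝ} (hφ : ContDiff ℝ ∞ φ) (i : Fin 2) :
    Continuous (partialD i φ) :=
  (hφ.continuous_fderiv (by simp)).clm_apply continuous_const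

theorem Continuous.integrableOn_hull {g : E2 → ℝ} (hg : Continuous g) (T : Finset E2) :
    IntegrableOn g (hull T) :=
  hg.continuousOn.integrableOn_compact (isCompact_hull T)

/-! ### Arc length on an edge -/

theorem exists_pair_of_mem_triEdges {T e : Finset E2} (he : e ∈ triEdges T) :
    ∃ p q, p ≠ q ∧ (e : Set E2) = {p, q} := by
  classical
  obtain ⟨p, q, hpq, rfl⟩ := Finset.card_eq_two.1 (Finset.mem_powersetCard.1 he).2
  exact ⟨p, q, hpq, by simp⟩

theorem isFiniteMeasure_edgeMeasure {T e : Finset E2} (he : e ∈ triEdges T) :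
    IsFiniteMeasure (edgeMeasure e) := by
  obtain ⟨p, q, -, h⟩ := exists_pair_of_mem_triEdges he
  constructor
  rw [edgeMeasure, Measure.restrict_apply_univ, hull_pair h, hausdorffMeasure_segment]
  exact edist_lt_top p q

theorem Continuous.memLp_edgeMeasure {T e : Finset E2} (he : e ∈ triEdges T) {g : E2 → ℝ}
    (hg : Continuous g) : MemLp g 2 (edgeMeasure e) := by
  have := isFiniteMeasure_edgeMeasure he
  obtain ⟨C, hC⟩ := (isCompact_hull e).exists_bound_of_continuousOn hg.continuousOn
  apply MemLp.of_bound hg.aestronglyMeasurable C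
  exact (ae_restrict_iff' (measurableSet_hull e)).2 (Filter.Eventually.of_forall hC)

theorem Continuous.integrable_edgeMeasure {T e : Finset E2} (he : e ∈ triEdges T) {g : E2 → ℝ}
    (hg : Continuous g) : Integrable g (edgeMeasure e) := by
  have := isFiniteMeasure_edgeMeasure he
  exact (Continuous.memLp_edgeMeasure he hg).integrable (by norm_num)

/-- Points have length zero. This disposes of the end points, near which the test functions that
define a jump vanish. -/
theorem ae_mem_openEdge (e : Finset E2) : ∀ᵐ x ∂(edgeMeasure e), x ∈ openEdge e := by
  rw [edgeMeasure, ae_restrict_iff' (measurableSet_hull e)]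
  have hn : (Measure.hausdorffMeasure 1 : Measure E2) (e : Set E2) = 0 := by
    have := Measure.nullSingletonClass_hausdorff E2 (d := 1) one_pos
    exact e.finite_toSet.measure_zero _
  filter_upwards [measure_eq_zero_iff_ae_notMem.1 hn] with x hx hxe
  exact ⟨hxe, hx⟩

theorem continuous_normalDerivP (v : PW) (T e : Finset E2) : Continuous (normalDerivP v T e) := by
  unfold normalDerivP
  exact continuous_finsetSum _ fun i _ => continuous_const.mul (continuous_pval _)

/-- Green's formula for a polynomial on a triangle. -/
theorem green_poly {T : Finset E2} {a b c : E2} (hT : IsTriangle T a b c) (v : PW) {φ : E2 → ℝ}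
    (hφ : ContDiff ℝ ∞ φ) :
    ∫ x in hull T, ((∑ i, hessP (v T) i i x) * φ x +
        ∑ i, pval (MvPolynomial.pderiv i (v T)) x * partialD i φ x) =
      ∑ e ∈ triEdges T, ∫ x, normalDerivP v T e x * φ x ∂(edgeMeasure e) := by
  set G : Fin 2 → E2 → ℝ := fun i x => pval (MvPolynomial.pderiv i (v T)) x * φ x with hG
  have hGs : ∀ i, ContDiff ℝ ∞ (G i) := fun i => (contDiff_pval _).mul hφ
  have hGc : ∀ i, Continuous (G i) := fun i => (hGs i).continuous
  have e1 : ∀ x, (∑ i, hessP (v T) i i x) * φ x +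
      ∑ i, pval (MvPolynomial.pderiv i (v T)) x * partialD i φ x = ∑ i, partialD i (G i) x := by
    intro x
    rw [Finset.sum_mul, ← Finset.sum_add_distrib]
    apply Finset.sum_congr rfl
    intro i _
    rw [hG, partialD_mul (differentiable_pval _ x) (hφ.differentiable (by simp) x), partialD_pval]
    rfl
  simp_rw [e1]
  rw [integral_finsetSum _ fun i _ => (continuous_partialD (hGs i) i).integrableOn_hull T]
  simp_rw [fun i => integral_partialD_triangle hT ((hGs i).of_le (by simp)) i]
  rw [Finset.sum_comm]
  apply Finset.sum_congr rfl
  intro e he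
  simp_rw [normalDerivP, Finset.sum_mul, mul_assoc]
  rw [integral_finsetSum (f := fun i x => outNormal T e i * G i x) _ fun i _ =>
    Continuous.integrable_edgeMeasure he (continuous_const.mul (hGc i))]
  simp_rw [integral_const_mul]

/-! ### Geometry of meshes -/

/-- Barycentric coordinates with respect to `b` and `c`. -/
noncomputable def bary (a b c x : E2) : ℝ × ℝ :=
  (det2 (x - a) (c - a) / det2 (b - a) (c - a), det2 (b - a) (x - a) / det2 (b - a) (c - a))

theorem triPt_bary {a b c : E2} (h : det2 (b - a) (c - a) ≠ 0) (x : E2) :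
    triPt a b c (bary a b c x) = x := by
  apply ext_E2 <;> simp [triPt, bary] <;> field_simp <;> simp [det2] <;> ring

theorem bary_triPt {a b c : E2} (h : det2 (b - a) (c - a) ≠ 0) (s : ℝ × ℝ) :
    bary a b c (triPt a b c s) = s := by
  apply Prod.ext <;> simp only [bary] <;> field_simp <;> simp [det2, triPt] <;> ring

theorem continuous_bary (a b c : E2) : Continuous (bary a b c) := by
  unfold bary det2
  simp only [PiLp.sub_apply]
  fun_prop

/-- A point of a triangle that is on none of the edges is in the interior. -/
theorem IsTriangle.mem_interior_or {T : Finset E2} {a b c x : E2} (hT : IsTriangle T a b c)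
    (hx : x ∈ hull T) : x ∈ interior (hull T) ∨ ∃ e ∈ triEdges T, x ∈ hull e := by
  classical
  rw [hT.triEdges_eq, hT.hull_eq, convexHull_eq_image_refTri] at *
  obtain ⟨s, ⟨h1, h2, h3⟩, rfl⟩ := hx
  have hab : hull ({a, b} : Finset E2) = segment ℝ a b := hull_pair (by simp)
  have hac : hull ({a, c} : Finset E2) = segment ℝ a c := hull_pair (by simp)
  have hbc : hull ({b, c} : Finset E2) = segment ℝ b c := hull_pair (by simp)
  rcases h1.eq_or_lt with h1 | h1
  · right
    refine ⟨{a, c}, by simp, ?_⟩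
    rw [hac, segment_eq_image']
    exact ⟨s.2, ⟨h2, by linarith⟩, by simp [triPt, ← h1]⟩
  rcases h2.eq_or_lt with h2 | h2
  · right
    refine ⟨{a, b}, by simp, ?_⟩
    rw [hab, segment_eq_image']
    exact ⟨s.1, ⟨h1.le, by linarith⟩, by simp [triPt, ← h2]⟩
  rcases h3.eq_or_lt with h3 | h3
  · right
    refine ⟨{b, c}, by simp, ?_⟩
    rw [hbc, segment_eq_image']
    refine ⟨s.2, ⟨h2.le, by linarith⟩, ?_⟩
    obtain h4 : s.1 = 1 - s.2 := by linarith
    rw [triPt, h4]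
    apply ext_E2 <;> simp <;> ring
  left
  rw [mem_interior]
  -- Strict positivity of the three barycentric coordinates is an open condition.
  refine ⟨bary a b c ⁻¹' {t | 0 < t.1 ∧ 0 < t.2 ∧ t.1 + t.2 < 1}, ?_, ?_, ?_⟩
  · intro y hy
    exact ⟨bary a b c y, ⟨hy.1.le, hy.2.1.le, hy.2.2.le⟩, triPt_bary hT.det_ne y⟩
  · apply IsOpen.preimage (continuous_bary a b c)
    exact (isOpen_lt continuous_const continuous_fst).inter
      ((isOpen_lt continuous_const continuous_snd).inter
        (isOpen_lt (continuous_fst.add continuous_snd) continuous_const))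
  · rw [Set.mem_preimage, bary_triPt hT.det_ne]
    exact ⟨h1, h2, h3⟩

theorem IsTriangle.volume_hull_edge {T e : Finset E2} {a b c : E2} (hT : IsTriangle T a b c)
    (he : e ∈ triEdges T) : volume (hull e) = 0 := by
  obtain ⟨o, p, q, h, hpq⟩ := hT.exists_of_mem he
  apply measure_mono_null (t := (affineSpan ℝ {p, q} : Set E2))
  · rw [hull, hpq]; exact convexHull_subset_affineSpan _
  · apply Measure.addHaar_affineSubspace
    intro htop
    have ho : o ∈ affineSpan ℝ {p, q} := by rw [htop]; trivial
    rw [mem_affineSpan_pair_iff_exists_lineMap_eq] at ho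
    obtain ⟨t, rfl⟩ := ho
    apply h.det_ne
    simp [det2, AffineMap.lineMap_apply]; ring

theorem hull_mono {s t : Finset E2} (h : s ⊆ t) : hull s ⊆ hull t :=
  convexHull_mono (Finset.coe_subset.2 h)

theorem subset_of_mem_triEdges {T e : Finset E2} (he : e ∈ triEdges T) : e ⊆ T :=
  (Finset.mem_powersetCard.1 he).1

namespace Mesh

variable {Ω : Set E2} (K : Mesh Ω)

theorem hull_subset_closure {T : Finset E2} (hT : T ∈ K.tri) : hull T ⊆ closure Ω := by
  rw [← K.cover]; exact Set.subset_biUnion_of_mem (u := fun T => hull T) hT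

/-- The mesh covers only `closure Ω`; that `Ω` is the interior of its closure excludes slits running
inside a triangle. -/
theorem interior_hull_subset (hΩ : IsPlateDomain Ω) {T : Finset E2} (hT : T ∈ K.tri) :
    interior (hull T) ⊆ Ω := by
  rw [← hΩ.interior_closure]
  exact interior_mono (K.hull_subset_closure hT)

theorem hull_ae_le (hΩ : IsPlateDomain Ω) {T : Finset E2} (hT : T ∈ K.tri) :
    volume (hull T \ Ω) = 0 := by
  apply measure_mono_null _ ((convex_convexHull ℝ (T : Set E2)).addHaar_frontier volume)
  rintro x ⟨h1, h2⟩
  exact ⟨subset_closure h1, fun h => h2 (K.interior_hull_subset hΩ hT h)⟩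

theorem restrict_hull_le (hΩ : IsPlateDomain Ω) {T : Finset E2} (hT : T ∈ K.tri) :
    volume.restrict (hull T) ≤ volume.restrict Ω :=
  Measure.restrict_mono_ae (by
    have := K.hull_ae_le hΩ hT
    rw [measure_eq_zero_iff_ae_notMem] at this
    filter_upwards [this] with x hx hxT
    by_contra h
    exact hx ⟨hxT, h⟩)

/-- Distinct triangles share at most two vertices, so by conformity they meet inside an edge. -/
theorem volume_hull_inter {T T' : Finset E2} (hT : T ∈ K.tri) (hT' : T' ∈ K.tri) (hne : T ≠ T') :
    volume (hull T ∩ hull T') = 0 := by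
  classical
  obtain ⟨a, b, c, h⟩ := K.exists_isTriangle hT
  have hss : T ∩ T' ⊆ T := Finset.inter_subset_left
  have hcard : (T ∩ T').card ≤ 2 := by
    by_contra! h3
    have h3T := K.card_tri T hT
    have h3T' := K.card_tri T' hT'
    have e1 : T ∩ T' = T := Finset.eq_of_subset_of_card_le hss (by omega)
    have e2 : T ∩ T' = T' := Finset.eq_of_subset_of_card_le Finset.inter_subset_right (by omega)
    exact hne (e1.symm.trans e2)
  obtain ⟨e, he1, he2, he3⟩ := Finset.exists_subsuperset_card_eq hss hcard
    (by rw [K.card_tri T hT]; norm_num)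
  rw [K.conforming T hT T' hT', ← Finset.coe_inter]
  exact measure_mono_null (hull_mono he1)
    (h.volume_hull_edge (Finset.mem_powersetCard.2 ⟨he2, he3⟩))

theorem sum_integral_hull (hΩ : IsPlateDomain Ω) {g : E2 → ℝ} (hg : IntegrableOn g Ω) :
    ∑ T ∈ K.tri, ∫ x in hull T, g x = ∫ x in Ω, g x := by
  have hae : (⋃ T : K.tri, hull T.1) =ᵐ[volume] Ω := by
    have hU : (⋃ T : K.tri, hull T.1) = closure Ω := by
      rw [← K.cover, Set.iUnion_subtype]
    have h0 : volume (closure Ω \ Ω) = 0 := by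
      rw [← hU, Set.iUnion_sdiff]
      exact measure_iUnion_null fun T => K.hull_ae_le hΩ T.2
    rw [hU]
    exact (ae_eq_set.2 ⟨h0, by rw [Set.sdiff_eq_empty.2 subset_closure]; simp⟩)
  rw [← setIntegral_congr_set hae, integral_iUnion_ae, tsum_fintype]
  · exact (Finset.sum_coe_sort K.tri fun T => ∫ x in hull T, g x).symm
  · exact fun T => (measurableSet_hull T.1).nullMeasurableSet
  · intro T T' hne
    exact K.volume_hull_inter T.2 T'.2 (fun h => hne (Subtype.ext h))
  · exact hg.congr_set_ae hae

theorem frontier_subset (hΩ : IsPlateDomain Ω) {x : E2} (hx : x ∈ frontier Ω) :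
    ∃ e, K.IsEdge e ∧ x ∈ hull e := by
  have hcl : x ∈ closure Ω := frontier_subset_closure hx
  rw [← K.cover] at hcl
  simp only [Set.mem_iUnion] at hcl
  obtain ⟨T, hT, hxT⟩ := hcl
  obtain ⟨a, b, c, h⟩ := K.exists_isTriangle hT
  rcases h.mem_interior_or hxT with h1 | ⟨e, he, hxe⟩
  · have := K.interior_hull_subset hΩ hT h1
    rw [hΩ.isOpen.frontier_eq] at hx
    exact absurd this hx.2
  · exact ⟨e, ⟨T, hT, he⟩, hxe⟩

/-- Faces meet in the hull of their common vertices: by conformity across two triangles, by affine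
independence within one. Two different edges have at most one common vertex. -/
theorem mem_of_mem_hull_inter {e e' : Finset E2} (he : K.IsEdge e) (he' : K.IsEdge e')
    (hne : e ≠ e') {x : E2} (hx : x ∈ hull e) (hx' : x ∈ hull e') : x ∈ e := by
  classical
  obtain ⟨T, hT, heT⟩ := he
  obtain ⟨T', hT', heT'⟩ := he'
  have hs := subset_of_mem_triEdges heT
  have hs' := subset_of_mem_triEdges heT'
  have h1 : x ∈ hull (T ∩ T') := by
    rw [hull, Finset.coe_inter, ← K.conforming T hT T' hT']
    exact ⟨hull_mono hs hx, hull_mono hs' hx'⟩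
  have h2 : x ∈ hull (e ∩ (T ∩ T')) := by
    rw [hull, Finset.coe_inter, (K.indep T hT).convexHull_inter hs Finset.inter_subset_left]
    exact ⟨hx, h1⟩
  have h3 : x ∈ hull ((e ∩ (T ∩ T')) ∩ e') := by
    rw [hull, Finset.coe_inter, (K.indep T' hT').convexHull_inter
      (Finset.inter_subset_right.trans Finset.inter_subset_right) hs']
    exact ⟨h2, hx'⟩
  have h4 : x ∈ hull (e ∩ e') := hull_mono (by intro y; simp; tauto) h3
  have hc := (Finset.mem_powersetCard.1 heT).2
  have hc' := (Finset.mem_powersetCard.1 heT').2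
  have hcard : (e ∩ e').card ≤ 1 := by
    by_contra! h
    have e1 : e ∩ e' = e := Finset.eq_of_subset_of_card_le Finset.inter_subset_left (by omega)
    have e2 : e ∩ e' = e' := Finset.eq_of_subset_of_card_le Finset.inter_subset_right (by omega)
    exact hne (e1.symm.trans e2)
  rw [Finset.card_le_one_iff_subset_singleton] at hcard
  obtain ⟨y, hy⟩ := hcard
  rw [Finset.subset_singleton_iff] at hy
  rcases hy with hy | hy
  · rw [hy, hull] at h4; simp at h4
  · rw [hy, hull] at h4
    simp at h4
    have : y ∈ e ∩ e' := by rw [hy]; simp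
    rw [h4]; exact (Finset.mem_inter.1 this).1

/-- Join `x` to the opposite vertex of a triangle at `e`. Hence a test function that vanishes near
all other edges also vanishes near the end points of `e`. -/
theorem exists_other_edge {e : Finset E2} (he : K.IsEdge e) {x : E2} (hx : x ∈ e) :
    ∃ e', K.IsEdge e' ∧ e' ≠ e ∧ x ∈ hull e' := by
  classical
  obtain ⟨T, hT, heT⟩ := he
  have hs := subset_of_mem_triEdges heT
  have hc := (Finset.mem_powersetCard.1 heT).2
  obtain ⟨o, hoT, hoe⟩ : ∃ o ∈ T, o ∉ e := by
    by_contra! h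
    have := Finset.card_le_card (show T ⊆ e from h)
    rw [K.card_tri T hT] at this; omega
  refine ⟨{o, x}, ⟨T, hT, Finset.mem_powersetCard.2 ⟨?_, ?_⟩⟩, ?_, ?_⟩
  · intro y hy
    simp only [Finset.mem_insert, Finset.mem_singleton] at hy
    rcases hy with rfl | rfl
    exacts [hoT, hs hx]
  · exact Finset.card_pair fun h => hoe (h ▸ hx)
  · intro h
    exact hoe (by rw [← h]; simp)
  · exact hull_subset_of_mem (by simp)

end Mesh

/-! ### Jumps of the normal derivative -/

namespace Mesh

variable {Ω : Set E2} (K : Mesh Ω)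

theorem finite_edges : {e | K.IsEdge e}.Finite := by
  classical
  apply (K.tri.biUnion triEdges).finite_toSet.subset
  rintro e ⟨T, hT, he⟩
  simp only [Finset.coe_biUnion, Set.mem_iUnion]
  exact ⟨T, hT, he⟩

/-- `normalJump` is an arbitrary choice among the functions satisfying Green's formula, so its norm
has a meaning only through this. Test functions supported off the other edges determine `J` on the
open set `U`, which contains the edge without its end points. -/
theorem isNormalJump_ae_unique {Dw : Finset E2 → Fin 2 → E2 → ℝ}
    {D2w : Finset E2 → Fin 2 → Fin 2 → E2 → ℝ} {e : Finset E2} (he : K.IsEdge e)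
    {J J' : E2 → ℝ} (h : K.IsNormalJump Dw D2w e J) (h' : K.IsNormalJump Dw D2w e J') :
    J =ᵐ[edgeMeasure e] J' := by
  obtain ⟨T, hT, heT⟩ := he
  have := isFiniteMeasure_edgeMeasure heT
  set U : Set E2 := (⋃ e' ∈ {e' | K.IsEdge e' ∧ e' ≠ e}, hull e')ᶜ with hU
  have hUo : IsOpen U := by
    rw [hU, isOpen_compl_iff]
    exact (K.finite_edges.subset fun e' h => h.1).isClosed_biUnion
      fun e' _ => (isCompact_hull e').isClosed
  have hJi : Integrable J (edgeMeasure e) := h.1.integrable (by norm_num)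
  have hJi' : Integrable J' (edgeMeasure e) := h'.1.integrable (by norm_num)
  have key := hUo.ae_eq_zero_of_integral_contDiff_smul_eq_zero (μ := edgeMeasure e)
    (f := fun x => J x - J' x) ((hJi.sub hJi').integrableOn.locallyIntegrableOn) (by
      intro φ hφ hφc hφU
      have hd : ∀ e', K.IsEdge e' → e' ≠ e → Disjoint (tsupport φ) (hull e') := by
        intro e' he' hne
        rw [Set.disjoint_left]
        intro x hx hxe
        exact hφU hx (Set.mem_biUnion (show e' ∈ {e' | K.IsEdge e' ∧ e' ≠ e} from ⟨he', hne⟩) hxe)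
      have e1 := h.2 φ ⟨hφ, hφc⟩ hd
      have e2 := h'.2 φ ⟨hφ, hφc⟩ hd
      rw [e1] at e2
      obtain ⟨C, hC⟩ := hφ.continuous.bounded_above_of_compact_support hφc
      have i1 : Integrable (fun x => J x * φ x) (edgeMeasure e) :=
        hJi.mul_bdd (c := C) hφ.continuous.aestronglyMeasurable (Filter.Eventually.of_forall hC)
      have i2 : Integrable (fun x => J' x * φ x) (edgeMeasure e) :=
        hJi'.mul_bdd (c := C) hφ.continuous.aestronglyMeasurable (Filter.Eventually.of_forall hC)
      have : ∀ x, φ x • (J x - J' x) = J x * φ x - J' x * φ x := by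
        intro x; rw [smul_eq_mul]; ring
      simp_rw [this]
      rw [integral_sub i1 i2, e2, sub_self])
  filter_upwards [key, ae_mem_openEdge e] with x hx hxo
  have hxU : x ∈ U := by
    rw [hU, Set.mem_compl_iff]
    simp only [Set.mem_iUnion, not_exists]
    intro e' he' hxe'
    exact hxo.2 (K.mem_of_mem_hull_inter ⟨T, hT, heT⟩ he'.1 he'.2.symm hxo.1 hxe')
  linarith [hx hxU]

/-- Test functions admitted in the definition of the jump on `e` are thereby admitted in the weak
clamped condition. A boundary point outside `Γc` cannot be on the open edge `e`, so it lies on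
another edge, possibly as an end point of `e`. -/
theorem disjoint_frontier_of_disjoint_edges (hΩ : IsPlateDomain Ω) {Γc : Set E2} {e : Finset E2}
    (he : K.IsEdge e) (hj : openEdge e ⊆ Ω ∨ openEdge e ⊆ Γc) {φ : E2 → ℝ}
    (hφ : ∀ e', K.IsEdge e' → e' ≠ e → Disjoint (tsupport φ) (hull e')) :
    Disjoint (tsupport φ) (frontier Ω \ Γc) := by
  rw [Set.disjoint_left]
  rintro x hx ⟨hxf, hxc⟩
  obtain ⟨e', he', hxe'⟩ := K.frontier_subset hΩ hxf
  by_cases hne : e' = e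
  · subst hne
    by_cases hxv : x ∈ e'
    · obtain ⟨e'', h1, h2, h3⟩ := K.exists_other_edge he hxv
      exact Set.disjoint_left.1 (hφ e'' h1 h2) hx h3
    · have hxo : x ∈ openEdge e' := ⟨hxe', hxv⟩
      rcases hj with hj | hj
      · rw [hΩ.isOpen.frontier_eq] at hxf
        exact hxf.2 (hj hxo)
      · exact hxc (hj hxo)
  · exact Set.disjoint_left.1 (hφ e' he' hne) hx hxe'

theorem continuous_jumpP (v : PW) (e : Finset E2) : Continuous (K.jumpP v e) := by
  unfold jumpP
  exact continuous_finsetSum _ fun T _ => continuous_normalDerivP v T e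

/-- The jump of a piecewise polynomial satisfies Green's formula. -/
theorem sum_green_poly (v : PW) {e : Finset E2} {φ : E2 → ℝ}
    (hφ : IsTest φ) (hφe : ∀ e', K.IsEdge e' → e' ≠ e → Disjoint (tsupport φ) (hull e'))
    (he : K.IsEdge e) :
    ∑ T ∈ K.tri, ∫ x in hull T, ((∑ i, hessP (v T) i i x) * φ x +
        ∑ i, pval (MvPolynomial.pderiv i (v T)) x * partialD i φ x) =
      ∫ x, K.jumpP v e x * φ x ∂(edgeMeasure e) := by
  classical
  obtain ⟨T₀, -, heT₀⟩ := he
  have h0 : ∀ T ∈ K.tri, ∫ x in hull T, ((∑ i, hessP (v T) i i x) * φ x +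
        ∑ i, pval (MvPolynomial.pderiv i (v T)) x * partialD i φ x) =
      if e ∈ triEdges T then ∫ x, normalDerivP v T e x * φ x ∂(edgeMeasure e) else 0 := by
    intro T hT
    obtain ⟨a, b, c, h⟩ := K.exists_isTriangle hT
    rw [green_poly h v hφ.1, ← Finset.sum_ite_eq' (triEdges T) e
      fun e => ∫ x, normalDerivP v T e x * φ x ∂(edgeMeasure e)]
    apply Finset.sum_congr rfl
    intro e' he'
    by_cases hne : e' = e
    · rw [if_pos hne]
    · rw [if_neg hne, edgeMeasure]
      apply setIntegral_eq_zero_of_forall_eq_zero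
      intro x hx
      have : x ∉ tsupport φ := fun hxs =>
        Set.disjoint_left.1 (hφe e' ⟨T, hT, he'⟩ hne) hxs hx
      rw [image_eq_zero_of_notMem_tsupport this, mul_zero]
  rw [Finset.sum_congr rfl h0, ← Finset.sum_filter, ← integral_finsetSum]
  · simp_rw [jumpP, Finset.sum_mul]
  · intro T _
    exact Continuous.integrable_edgeMeasure heT₀
      ((continuous_normalDerivP v T e).mul hφ.1.continuous)

/-- The jump of `u - v` is that of `-v`, if `u` is in the energy space. -/
theorem isNormalJump_sub (hΩ : IsPlateDomain Ω) {Γc : Set E2} {Du : Fin 2 → E2 → ℝ}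
    {D2u : Fin 2 → Fin 2 → E2 → ℝ} (hDu : ∀ i, MemLp (Du i) 2 (volume.restrict Ω))
    (hD2u : ∀ i j, MemLp (D2u i j) 2 (volume.restrict Ω))
    (hn : NormalDerivVanishesOn Ω Γc Du D2u) (v : PW) {e : Finset E2} (he : K.IsEdge e)
    (hj : openEdge e ⊆ Ω ∨ openEdge e ⊆ Γc) :
    K.IsNormalJump (fun T' i x => Du i x - pval (MvPolynomial.pderiv i (v T')) x)
      (fun T' i j x => D2u i j x - hessP (v T') i j x) e (fun x => -K.jumpP v e x) := by
  have heT := he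
  obtain ⟨T₀, -, heT₀⟩ := heT
  refine ⟨Continuous.memLp_edgeMeasure heT₀ (K.continuous_jumpP v e).neg, ?_⟩
  intro φ hφ hφe
  have hfin : IsFiniteMeasure (volume.restrict Ω) :=
    ⟨by rw [Measure.restrict_apply_univ]; exact hΩ.isBounded.measure_lt_top⟩
  have bdd : ∀ {w g : E2 → ℝ}, MemLp w 2 (volume.restrict Ω) → Continuous g →
      HasCompactSupport g → Integrable (fun x => w x * g x) (volume.restrict Ω) := by
    intro w g hw hg hgc
    obtain ⟨C, hC⟩ := hg.bounded_above_of_compact_support hgc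
    exact (hw.integrable (by norm_num)).mul_bdd (c := C) hg.aestronglyMeasurable
      (Filter.Eventually.of_forall hC)
  have hφ' : ∀ i, HasCompactSupport (partialD i φ) := fun i => hφ.2.fderiv_apply (𝕜 := ℝ) _
  have iu : IntegrableOn (fun x => (∑ i, D2u i i x) * φ x + ∑ i, Du i x * partialD i φ x) Ω := by
    apply Integrable.add
    · simp_rw [Finset.sum_mul]
      exact integrable_finsetSum _ fun i _ => bdd (hD2u i i) hφ.1.continuous hφ.2
    · exact integrable_finsetSum _ fun i _ => bdd (hDu i) (continuous_partialD hφ.1 i) (hφ' i)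
  have hu := K.sum_integral_hull hΩ iu
  -- The triangle contributions of `u` add up to an integral over `Ω`, which the clamped condition
  -- makes zero; only those of `v` remain.
  rw [hn φ hφ (K.disjoint_frontier_of_disjoint_edges hΩ he hj hφe)] at hu
  have hv := K.sum_green_poly v hφ hφe he
  simp_rw [neg_mul]
  rw [integral_neg, ← hv, ← zero_sub, ← hu, ← Finset.sum_sub_distrib]
  apply Finset.sum_congr rfl
  intro T hT
  rw [← integral_sub]
  · congr 1
    funext x
    simp only [Fin.sum_univ_two]
    ring
  · exact Integrable.mono_measure iu (K.restrict_hull_le hΩ hT)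
  · apply Continuous.integrableOn_hull
    apply Continuous.add
    · exact (continuous_finsetSum _ fun i _ => continuous_pval _).mul hφ.1.continuous
    · exact continuous_finsetSum _ fun i _ => (continuous_pval _).mul (continuous_partialD hφ.1 i)

/-- Uniqueness identifies the chosen jump with `-jumpP v e`, and the sign disappears on squaring.
The jump part of the estimator is thus efficient with constant one. -/
theorem integral_normalJump_sq (hΩ : IsPlateDomain Ω) {Γc : Set E2} {Du : Fin 2 → E2 → ℝ}
    {D2u : Fin 2 → Fin 2 → E2 → ℝ} (hDu : ∀ i, MemLp (Du i) 2 (volume.restrict Ω))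
    (hD2u : ∀ i j, MemLp (D2u i j) 2 (volume.restrict Ω))
    (hn : NormalDerivVanishesOn Ω Γc Du D2u) (v : PW) {e : Finset E2} (he : K.IsEdge e)
    (hj : openEdge e ⊆ Ω ∨ openEdge e ⊆ Γc) :
    ∫ x, (K.normalJump (fun T' i x => Du i x - pval (MvPolynomial.pderiv i (v T')) x)
      (fun T' i j x => D2u i j x - hessP (v T') i j x) e x) ^ 2 ∂(edgeMeasure e) =
    ∫ x, (K.jumpP v e x) ^ 2 ∂(edgeMeasure e) := by
  have hJ := K.isNormalJump_sub hΩ hDu hD2u hn v he hj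
  have hex : ∃ J, K.IsNormalJump (fun T' i x => Du i x - pval (MvPolynomial.pderiv i (v T')) x)
      (fun T' i j x => D2u i j x - hessP (v T') i j x) e J := ⟨_, hJ⟩
  have hae := K.isNormalJump_ae_unique he hex.choose_spec hJ
  apply integral_congr_ae
  rw [normalJump, dif_pos hex]
  filter_upwards [hae] with x hx
  rw [hx, neg_sq]

end Mesh

/-! ### Degrees -/

theorem totalDegree_pderiv_le (p : Poly2) (i : Fin 2) :
    (MvPolynomial.pderiv i p).totalDegree ≤ p.totalDegree := by
  conv_lhs => rw [p.as_sum, map_sum]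
  refine (MvPolynomial.totalDegree_finsetSum _ _).trans (Finset.sup_le fun m hm => ?_)
  rw [MvPolynomial.pderiv_monomial]
  refine (MvPolynomial.totalDegree_monomial_le _ _).trans ?_
  refine le_trans ?_ (MvPolynomial.le_totalDegree hm)
  rw [Finsupp.sum_fintype _ _ (fun _ => rfl), Finsupp.sum_fintype _ _ (fun _ => rfl)]
  apply Finset.sum_le_sum
  intro j _
  simp

theorem totalDegree_aeval_le {g : Fin 2 → Poly2} (hg : ∀ i, (g i).totalDegree ≤ 1) (p : Poly2) :
    (MvPolynomial.aeval g p).totalDegree ≤ p.totalDegree := by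
  conv_lhs => rw [p.as_sum, map_sum]
  refine (MvPolynomial.totalDegree_finsetSum _ _).trans (Finset.sup_le fun m hm => ?_)
  rw [MvPolynomial.aeval_monomial, MvPolynomial.algebraMap_eq]
  refine le_trans ?_ (MvPolynomial.le_totalDegree hm)
  refine (MvPolynomial.totalDegree_mul _ _).trans ?_
  rw [MvPolynomial.totalDegree_C, zero_add, Finsupp.prod_fintype _ _ (fun _ => pow_zero _),
    Finsupp.sum_fintype _ _ (fun _ => rfl)]
  refine (MvPolynomial.totalDegree_finsetProd _ _).trans (Finset.sum_le_sum fun i _ => ?_)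
  refine (MvPolynomial.totalDegree_pow _ _).trans ?_
  exact (Nat.mul_le_mul_left _ (hg i)).trans (by simp)

/-! ### Polynomials on the reference triangle -/

/-- The value of a polynomial at a point of the reference plane. -/
noncomputable def refVal (q : Poly2) (s : ℝ × ℝ) : ℝ := MvPolynomial.eval ![s.1, s.2] q

theorem continuous_refVal (q : Poly2) : Continuous (refVal q) := by
  unfold refVal
  exact (MvPolynomial.continuous_eval q).comp (by fun_prop)

theorem integrableOn_refVal (q : Poly2) : IntegrableOn (refVal q) refTri :=
  (continuous_refVal q).continuousOn.integrableOn_compact isCompact_refTri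

/-- The integral over the reference triangle. -/
noncomputable def refInt : Poly2 →ₗ[ℝ] ℝ where
  toFun q := ∫ s in refTri, refVal q s
  map_add' p q := by
    rw [← integral_add (integrableOn_refVal p) (integrableOn_refVal q)]
    simp [refVal]
  map_smul' t q := by
    rw [RingHom.id_apply, smul_eq_mul, ← integral_const_mul]
    simp [refVal, MvPolynomial.smul_eval]

theorem refInt_apply (q : Poly2) : refInt q = ∫ s in refTri, refVal q s := rfl

/-- The cubic bubble function. -/
noncomputable def refBubble : Poly2 :=
  MvPolynomial.X 0 * MvPolynomial.X 1 * (1 - MvPolynomial.X 0 - MvPolynomial.X 1)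

theorem refVal_refBubble (s : ℝ × ℝ) : refVal refBubble s = s.1 * s.2 * (1 - s.1 - s.2) := by
  simp [refVal, refBubble]

theorem refVal_mul (p q : Poly2) (s : ℝ × ℝ) : refVal (p * q) s = refVal p s * refVal q s := by
  simp [refVal]

theorem refInt_mul_self_nonneg (q : Poly2) : 0 ≤ refInt (q * q) := by
  rw [refInt_apply]
  apply integral_nonneg
  intro s
  simp only [refVal_mul]
  exact mul_self_nonneg _

/-- Definiteness of the bubble-weighted norm: `b * q` vanishes on the open square `V`, where `b >
0`, and a polynomial that vanishes on a product of infinite sets is zero. -/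
theorem eq_zero_of_refInt_bubble {q : Poly2}
    (h : refInt (refBubble * q * (refBubble * q)) = 0) : q = 0 := by
  rw [refInt_apply, setIntegral_eq_zero_iff_of_nonneg_ae
    (Filter.Eventually.of_forall fun s => by
      simp only [refVal_mul]; exact mul_self_nonneg _) (integrableOn_refVal _)] at h
  set V : Set (ℝ × ℝ) := Set.Ioo 0 (1 / 2) ×ˢ Set.Ioo 0 (1 / 2) with hV
  have hVo : IsOpen V := isOpen_Ioo.prod isOpen_Ioo
  have hVs : V ⊆ refTri := by
    rintro s ⟨h1, h2⟩
    exact ⟨h1.1.le, h2.1.le, by have := h1.2; have := h2.2; linarith⟩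
  have h2 := Measure.eqOn_open_of_ae_eq (ae_restrict_of_ae_restrict_of_subset hVs h) hVo
    (continuous_refVal _).continuousOn continuousOn_const
  apply MvPolynomial.funext_set (fun _ => Set.Ioo (0 : ℝ) (1 / 2))
    (fun _ => Set.Ioo_infinite (by norm_num))
  intro x hx
  have hx0 := hx 0 trivial
  have hx1 := hx 1 trivial
  have h3 := h2 (show (x 0, x 1) ∈ V from ⟨hx0, hx1⟩)
  simp only [refVal_mul, refVal_refBubble, Pi.zero_apply, mul_self_eq_zero] at h3
  have h4 : x 0 * x 1 * (1 - x 0 - x 1) ≠ 0 := by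
    have := hx0.1; have := hx1.1; have := hx0.2; have := hx1.2
    have h5 : 0 < 1 - x 0 - x 1 := by linarith
    positivity
  have h6 := (mul_eq_zero.1 h3).resolve_left h4
  rw [map_zero, ← h6, refVal]
  congr 1
  congr 1
  funext i; fin_cases i <;> rfl

theorem exists_bilinear_le_norm_sq {V : Type*} [NormedAddCommGroup V] [NormedSpace ℝ V]
    [FiniteDimensional ℝ V] (B : V →ₗ[ℝ] V →ₗ[ℝ] ℝ) : ∃ C, ∀ x, B x x ≤ C * (‖x‖ * ‖x‖) := by
  let F : V →L[ℝ] V →L[ℝ] ℝ := LinearMap.toContinuousLinearMap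
    ((LinearMap.toContinuousLinearMap : (V →ₗ[ℝ] ℝ) ≃ₗ[ℝ] _).toLinearMap ∘ₗ B)
  refine ⟨‖F‖, fun x => ?_⟩
  rw [← mul_assoc]
  exact (le_abs_self _).trans (F.le_opNorm₂ x x)

/-- A bilinear form on a finite-dimensional space is bounded by a positive definite one. -/
theorem exists_bound_of_posDef {V : Type*} [AddCommGroup V] [Module ℝ V] [FiniteDimensional ℝ V]
    (B B' : V →ₗ[ℝ] V →ₗ[ℝ] ℝ) (hs : ∀ x y, B x y = B y x) (h0 : ∀ x, 0 ≤ B x x)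
    (hd : ∀ x, B x x = 0 → x = 0) : ∃ C, ∀ x, B' x x ≤ C * B x x := by
  -- With `B` as inner product, `B x x` is the squared norm, and boundedness of `B'` in finite
  -- dimension gives the claim.
  let core : InnerProductSpace.Core ℝ V :=
    { inner := fun x y => B x y
      conj_inner_symm := fun x y => hs y x
      re_inner_nonneg := h0
      add_left := fun x y z => by simp
      smul_left := fun x y r => by simp
      definite := hd }
  let _ : NormedAddCommGroup V := core.toNormedAddCommGroup
  let _ : InnerProductSpace ℝ V := InnerProductSpace.ofCore core.toCore
  have key : ∃ C, ∀ x : V, B' x x ≤ C * (‖x‖ * ‖x‖) := exists_bilinear_le_norm_sq B'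
  obtain ⟨C, hC⟩ := key
  refine ⟨C, fun x => ?_⟩
  have h2 : B x x = ‖x‖ * ‖x‖ := by
    rw [← real_inner_self_eq_norm_mul_norm]; rfl
  rw [h2]
  exact hC x

/-- The bubble-weighted `L²` norm controls every quadratic functional of this form. -/
theorem exists_refInt_le (r : ℕ) (L : Poly2 →ₗ[ℝ] Poly2) : ∃ C : ℝ, ∀ q : Poly2,
    q.totalDegree ≤ r → refInt (L q * L q) ≤ C * refInt (refBubble * q * (refBubble * q)) := by
  -- Only the argument is restricted to degree at most `r`; `M` may raise the degree, since its
  -- values are merely integrated.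
  let form : (Poly2 →ₗ[ℝ] Poly2) → (MvPolynomial.restrictTotalDegree (Fin 2) ℝ r →ₗ[ℝ]
      MvPolynomial.restrictTotalDegree (Fin 2) ℝ r →ₗ[ℝ] ℝ) := fun M =>
    ((LinearMap.mul ℝ Poly2).compl₁₂ (M ∘ₗ Submodule.subtype _)
      (M ∘ₗ Submodule.subtype _)).compr₂ refInt
  have hform : ∀ M x y, form M x y = refInt (M x * M y) := fun M x y => rfl
  obtain ⟨C, hC⟩ := exists_bound_of_posDef (form (LinearMap.mulLeft ℝ refBubble)) (form L)
    (fun x y => by rw [hform, hform, mul_comm])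
    (fun x => by rw [hform]; exact refInt_mul_self_nonneg _)
    (fun x hx => by
      rw [hform] at hx
      exact Subtype.ext (eq_zero_of_refInt_bubble hx))
  refine ⟨C, fun q hq => ?_⟩
  exact hC ⟨q, (MvPolynomial.mem_restrictTotalDegree _ _ _).2 hq⟩

/-! ### Transfer between a triangle and the reference triangle -/

/-- The gradients of the barycentric coordinates. -/
noncomputable def baryGrad (a b c : E2) : Matrix (Fin 2) (Fin 2) ℝ :=
  !![(c - a) 1 / det2 (b - a) (c - a), -(c - a) 0 / det2 (b - a) (c - a);
    -(b - a) 1 / det2 (b - a) (c - a), (b - a) 0 / det2 (b - a) (c - a)]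

/-- The barycentric coordinates as polynomials. -/
noncomputable def baryPoly (a b c : E2) (k : Fin 2) : Poly2 :=
  MvPolynomial.C (baryGrad a b c k 0) * (MvPolynomial.X 0 - MvPolynomial.C (a 0)) +
    MvPolynomial.C (baryGrad a b c k 1) * (MvPolynomial.X 1 - MvPolynomial.C (a 1))

/-- The polynomial on the triangle that corresponds to `q` on the reference triangle. -/
noncomputable def pushPoly (a b c : E2) (q : Poly2) : Poly2 :=
  MvPolynomial.aeval (baryPoly a b c) q

/-- The polynomial on the reference triangle that corresponds to `p` on the triangle. -/
noncomputable def pullPoly (a b c : E2) (p : Poly2) : Poly2 :=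
  MvPolynomial.aeval (fun i => MvPolynomial.C (a i) +
    MvPolynomial.C ((b - a) i) * MvPolynomial.X 0 +
    MvPolynomial.C ((c - a) i) * MvPolynomial.X 1 : Fin 2 → Poly2) p

theorem pval_pushPoly (a b c : E2) (q : Poly2) (x : E2) :
    pval (pushPoly a b c q) x = refVal q (bary a b c x) := by
  unfold pushPoly pval refVal
  rw [MvPolynomial.aeval_def, MvPolynomial.eval₂_comp_left, MvPolynomial.eval,
    MvPolynomial.coe_eval₂Hom]
  congr 1
  · ext; simp
  · funext k
    fin_cases k <;> simp [baryPoly, baryGrad, bary, det2] <;> ring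

theorem refVal_pullPoly (a b c : E2) (p : Poly2) (s : ℝ × ℝ) :
    refVal (pullPoly a b c p) s = pval p (triPt a b c s) := by
  unfold pullPoly pval refVal
  rw [MvPolynomial.aeval_def, MvPolynomial.eval₂_comp_left, MvPolynomial.eval,
    MvPolynomial.coe_eval₂Hom]
  congr 1
  · ext; simp
  · funext k
    simp [triPt]; ring

theorem totalDegree_pullPoly_le (a b c : E2) (p : Poly2) :
    (pullPoly a b c p).totalDegree ≤ p.totalDegree := by
  apply totalDegree_aeval_le
  intro i
  have hX : ∀ (t : ℝ) (j : Fin 2),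
      (MvPolynomial.C t * MvPolynomial.X j : Poly2).totalDegree ≤ 1 := fun t j =>
    (MvPolynomial.totalDegree_mul _ _).trans (by simp)
  refine (MvPolynomial.totalDegree_add _ _).trans (max_le ?_ (hX _ _))
  exact (MvPolynomial.totalDegree_add _ _).trans (max_le (by simp) (hX _ _))

/-- The chain rule. Each derivative costs one barycentric gradient, the only way in which the shape
of the triangle enters. -/
theorem pderiv_pushPoly (a b c : E2) (q : Poly2) (i : Fin 2) :
    MvPolynomial.pderiv i (pushPoly a b c q) =
      ∑ k, MvPolynomial.C (baryGrad a b c k i) * pushPoly a b c (MvPolynomial.pderiv k q) := by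
  unfold pushPoly
  induction q using MvPolynomial.induction_on with
  | C t => simp
  | add p q hp hq => simp only [map_add, hp, hq, mul_add, Finset.sum_add_distrib]
  | mul_X p j hp =>
    have hb : MvPolynomial.pderiv i (baryPoly a b c j) = MvPolynomial.C (baryGrad a b c j i) := by
      fin_cases i <;> simp [baryPoly, Derivation.leibniz, MvPolynomial.pderiv_X]
    rw [map_mul, Derivation.leibniz, hp, MvPolynomial.aeval_X, hb]
    simp only [Derivation.leibniz, MvPolynomial.pderiv_X, smul_eq_mul, map_add, map_mul,
      MvPolynomial.aeval_X, Fin.sum_univ_two]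
    fin_cases j <;> simp <;> ring

/-- The Jacobian is one constant for all integrals over `T`, so inequalities between integrals
transfer from the reference triangle with the same constant. -/
theorem integral_pval_mul {T : Finset E2} {a b c : E2} (hT : IsTriangle T a b c) (q : Poly2)
    {g : E2 → ℝ} (hg : ∀ x, g x = refVal q (bary a b c x)) :
    ∫ x in hull T, g x = |det2 (b - a) (c - a)| * refInt q := by
  rw [hT.hull_eq, integral_triangle hT.det_ne, refInt_apply]
  simp_rw [hg, bary_triPt hT.det_ne]

/-! ### Bubble functions on a triangle -/

theorem refInt_mono {p q : Poly2} (h : ∀ s, refVal p s ≤ refVal q s) : refInt p ≤ refInt q :=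
  integral_mono (integrableOn_refVal p) (integrableOn_refVal q) h

theorem IsTriangle.refVal_refBubble_eq_zero {T e : Finset E2} {a b c x : E2}
    (hT : IsTriangle T a b c) (he : e ∈ triEdges T) (hx : x ∈ hull e) :
    refVal refBubble (bary a b c x) = 0 := by
  classical
  rw [hT.triEdges_eq] at he
  simp only [Finset.mem_insert, Finset.mem_singleton] at he
  rcases he with rfl | rfl | rfl
  · rw [hull_pair (p := a) (q := b) (by simp), segment_eq_image'] at hx
    obtain ⟨t, -, rfl⟩ := hx
    have : a + t • (b - a) = triPt a b c (t, 0) := by simp [triPt]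
    simp only [this, bary_triPt hT.det_ne, refVal_refBubble]
    ring
  · rw [hull_pair (p := a) (q := c) (by simp), segment_eq_image'] at hx
    obtain ⟨t, -, rfl⟩ := hx
    have : a + t • (c - a) = triPt a b c (0, t) := by simp [triPt]
    simp only [this, bary_triPt hT.det_ne, refVal_refBubble]
    ring
  · rw [hull_pair (p := b) (q := c) (by simp), segment_eq_image'] at hx
    obtain ⟨t, -, rfl⟩ := hx
    have : b + t • (c - b) = triPt a b c (1 - t, t) := by
      apply ext_E2 <;> simp [triPt] <;> ring
    simp only [this, bary_triPt hT.det_ne, refVal_refBubble]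
    ring

/-- `v` vanishes on the boundary of the triangle `T`. -/
def VanishesOnEdges (T : Finset E2) (v : Poly2) : Prop :=
  ∀ e ∈ triEdges T, ∀ x ∈ hull e, pval v x = 0

/-- Cauchy–Schwarz for four terms, meant for `x k l` a product of two barycentric gradients. -/
theorem sq_sum_four_le {γ : ℝ} {x y : Fin 2 → Fin 2 → ℝ} (hx : ∀ k l, |x k l| ≤ γ ^ 2) :
    (∑ k, ∑ l, x k l * y k l) ^ 2 ≤ 4 * γ ^ 4 * ∑ k, ∑ l, y k l * y k l := by
  have h : ∀ k l, (x k l * y k l) ^ 2 ≤ γ ^ 4 * (y k l * y k l) := by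
    intro k l
    have h1 : x k l ^ 2 ≤ γ ^ 4 := by
      calc x k l ^ 2 = |x k l| ^ 2 := (sq_abs _).symm
        _ ≤ (γ ^ 2) ^ 2 := pow_le_pow_left₀ (abs_nonneg _) (hx k l) 2
        _ = γ ^ 4 := by ring
    nlinarith [mul_self_nonneg (y k l)]
  have h1 := h 0 0
  have h2 := h 0 1
  have h3 := h 1 0
  have h4 := h 1 1
  simp only [Fin.sum_univ_two]
  generalize x 0 0 * y 0 0 = A at *
  generalize x 0 1 * y 0 1 = B at *
  generalize x 1 0 * y 1 0 = C at *
  generalize x 1 1 * y 1 1 = D at *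
  nlinarith [sq_nonneg (A - B), sq_nonneg (A - C), sq_nonneg (A - D), sq_nonneg (B - C),
    sq_nonneg (B - D), sq_nonneg (C - D)]

/-- Take `v = b² p`; the square makes `∇v` vanish on `∂T` as well. Then `∫ p v` is the Jacobian
times `n`, the squared norm of `b q` on the reference triangle, and `n` dominates the other
quantities by `exists_refInt_le`. Squaring a Hessian entry produces the factor `γ ^ 4`. -/
theorem exists_bubble (r : ℕ) : ∃ C : ℝ, 0 < C ∧ ∀ (T : Finset E2) (a b c : E2),
    IsTriangle T a b c → ∀ p : Poly2, p.totalDegree ≤ r → ∃ v : Poly2,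
      VanishesOnEdges T v ∧ (∀ i, VanishesOnEdges T (MvPolynomial.pderiv i v)) ∧
      0 ≤ ∫ x in hull T, pval p x * pval v x ∧
      ∫ x in hull T, pval p x ^ 2 ≤ C * ∫ x in hull T, pval p x * pval v x ∧
      ∫ x in hull T, pval v x ^ 2 ≤ C * ∫ x in hull T, pval p x * pval v x ∧
      ∀ γ : ℝ, (∀ k i, |baryGrad a b c k i| ≤ γ) → ∀ i j,
        ∫ x in hull T, hessP v i j x ^ 2 ≤ C * γ ^ 4 * ∫ x in hull T, pval p x * pval v x := by
  let M : Poly2 →ₗ[ℝ] Poly2 :=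
    LinearMap.mulLeft ℝ refBubble ∘ₗ LinearMap.mulLeft ℝ refBubble
  let D (k : Fin 2) : Poly2 →ₗ[ℝ] Poly2 := (MvPolynomial.pderiv k : Derivation ℝ Poly2 Poly2)
  obtain ⟨C₁, h₁⟩ := exists_refInt_le r LinearMap.id
  obtain ⟨C₂, h₂⟩ := exists_refInt_le r M
  choose C₃ h₃ using fun k l : Fin 2 => exists_refInt_le r (D l ∘ₗ D k ∘ₗ M)
  set S := ∑ k, ∑ l, |C₃ k l| with hS
  have hS0 : 0 ≤ S := Finset.sum_nonneg fun k _ => Finset.sum_nonneg fun l _ => abs_nonneg _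
  -- One constant for all estimates: absolute values since the `Cᵢ` carry no sign, `4` from
  -- `sq_sum_four_le`, and `1` for positivity.
  refine ⟨|C₁| + |C₂| + 4 * S + 1, by positivity, ?_⟩
  intro T a b c hT p hp
  set q := pullPoly a b c p with hq
  have hqr : q.totalDegree ≤ r := (totalDegree_pullPoly_le a b c p).trans hp
  set n := refInt (refBubble * q * (refBubble * q)) with hn
  have hn0 : 0 ≤ n := refInt_mul_self_nonneg _
  set w := M q with hw
  have hwq : w = refBubble * (refBubble * q) := rfl
  have hpq : ∀ x, pval p x = refVal q (bary a b c x) := fun x => by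
    rw [hq, refVal_pullPoly, triPt_bary hT.det_ne]
  have hv : ∀ x, pval (pushPoly a b c w) x = refVal w (bary a b c x) := pval_pushPoly a b c w
  set Δ := |det2 (b - a) (c - a)| with hΔ
  have hΔ0 : 0 ≤ Δ := abs_nonneg _
  have hN : ∫ x in hull T, pval p x * pval (pushPoly a b c w) x = Δ * n := by
    apply integral_pval_mul hT
    intro x
    rw [hpq, hv, hwq]
    simp only [refVal_mul]; ring
  refine ⟨pushPoly a b c w, ?_, ?_, ?_, ?_, ?_, ?_⟩
  · intro e he x hx
    rw [hv, hwq, refVal_mul, hT.refVal_refBubble_eq_zero he hx, zero_mul]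
  · intro i e he x hx
    rw [pderiv_pushPoly, pval_sum]
    apply Finset.sum_eq_zero
    intro k _
    -- Every term of the derivative of `b * b * q` retains a factor `b`.
    rw [pval_mul, pval_pushPoly, hwq, ← mul_assoc, Derivation.leibniz, Derivation.leibniz]
    have h0 := hT.refVal_refBubble_eq_zero he hx
    simp only [refVal] at h0 ⊢
    simp [h0]
  · rw [hN]; positivity
  · rw [hN, integral_pval_mul hT (q * q) (fun x => by rw [hpq, refVal_mul, sq])]
    have : refInt (q * q) ≤ |C₁| * n :=
      (h₁ q hqr).trans (mul_le_mul_of_nonneg_right (le_abs_self _) hn0)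
    calc Δ * refInt (q * q) ≤ Δ * (|C₁| * n) := mul_le_mul_of_nonneg_left this hΔ0
      _ = |C₁| * (Δ * n) := by ring
      _ ≤ (|C₁| + |C₂| + 4 * S + 1) * (Δ * n) := by
        apply mul_le_mul_of_nonneg_right _ (by positivity)
        linarith [abs_nonneg C₂]
  · rw [hN, integral_pval_mul hT (w * w) (fun x => by rw [hv, refVal_mul, sq])]
    have : refInt (w * w) ≤ |C₂| * n :=
      (h₂ q hqr).trans (mul_le_mul_of_nonneg_right (le_abs_self _) hn0)
    calc Δ * refInt (w * w) ≤ Δ * (|C₂| * n) := mul_le_mul_of_nonneg_left this hΔ0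
      _ = |C₂| * (Δ * n) := by ring
      _ ≤ (|C₁| + |C₂| + 4 * S + 1) * (Δ * n) := by
        apply mul_le_mul_of_nonneg_right _ (by positivity)
        linarith [abs_nonneg C₁]
  · intro γ hγ i j
    set W : Fin 2 → Fin 2 → Poly2 := fun k l => D l (D k w) with hW
    set G : Fin 2 → Fin 2 → ℝ := fun k l => baryGrad a b c k i * baryGrad a b c l j with hG
    have hγ0 : 0 ≤ γ := (abs_nonneg _).trans (hγ 0 0)
    have hGγ : ∀ k l, |G k l| ≤ γ ^ 2 := by
      intro k l
      rw [hG, abs_mul, sq]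
      exact mul_le_mul (hγ k i) (hγ l j) (abs_nonneg _) hγ0
    set Q : Poly2 := ∑ k, ∑ l, MvPolynomial.C (G k l) * W k l with hQ
    have hess : ∀ x, hessP (pushPoly a b c w) i j x = refVal Q (bary a b c x) := by
      intro x
      rw [hessP, pderiv_pushPoly, map_sum, pval_sum, hQ, refVal, map_sum]
      apply Finset.sum_congr rfl
      intro k _
      rw [← MvPolynomial.smul_eq_C_mul, Derivation.map_smul, pderiv_pushPoly,
        MvPolynomial.smul_eq_C_mul, pval_mul, pval_sum, map_sum, pval_C, Finset.mul_sum]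
      apply Finset.sum_congr rfl
      intro l _
      rw [pval_mul, pval_pushPoly, pval_C, map_mul, MvPolynomial.eval_C, hG, mul_assoc]
      rfl
    have hQV : ∀ s, refVal Q s = ∑ k, ∑ l, G k l * refVal (W k l) s := by
      intro s; simp [hQ, refVal]
    have hQ2 : refInt (Q * Q) ≤ 4 * γ ^ 4 * ∑ k, ∑ l, refInt (W k l * W k l) := by
      have e1 : 4 * γ ^ 4 * ∑ k, ∑ l, refInt (W k l * W k l) =
          refInt ((4 * γ ^ 4) • ∑ k, ∑ l, W k l * W k l) := by
        simp; ring
      rw [e1]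
      apply refInt_mono
      intro s
      have e2 : refVal ((4 * γ ^ 4) • ∑ k, ∑ l, W k l * W k l) s =
          4 * γ ^ 4 * ∑ k, ∑ l, refVal (W k l) s * refVal (W k l) s := by
        simp [refVal, MvPolynomial.smul_eval]; ring
      rw [e2, refVal_mul, hQV, ← sq]
      exact sq_sum_four_le hGγ
    have hsum : ∑ k, ∑ l, refInt (W k l * W k l) ≤ S * n := by
      rw [hS, Finset.sum_mul]
      apply Finset.sum_le_sum
      intro k _
      rw [Finset.sum_mul]
      apply Finset.sum_le_sum
      intro l _
      exact (h₃ k l q hqr).trans (mul_le_mul_of_nonneg_right (le_abs_self _) hn0)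
    rw [hN, integral_pval_mul hT (Q * Q) (fun x => by rw [hess, refVal_mul, sq])]
    calc Δ * refInt (Q * Q) ≤ Δ * (4 * γ ^ 4 * (S * n)) := by
          apply mul_le_mul_of_nonneg_left _ hΔ0
          exact hQ2.trans (mul_le_mul_of_nonneg_left hsum (by positivity))
      _ = (4 * S) * (γ ^ 4 * (Δ * n)) := by ring
      _ ≤ (|C₁| + |C₂| + 4 * S + 1) * (γ ^ 4 * (Δ * n)) := by
        apply mul_le_mul_of_nonneg_right _ (by positivity)
        linarith [abs_nonneg C₁, abs_nonneg C₂]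
      _ = _ := by ring

/-! ### Shape regularity -/

theorem IsTriangle.volume_hull {T : Finset E2} {a b c : E2} (hT : IsTriangle T a b c) :
    (volume (hull T)).toReal = |det2 (b - a) (c - a)| / 2 := by
  have h1 : ∫ x in hull T, (1 : ℝ) = (volume (hull T)).toReal := by
    simp [Measure.real]
  rw [← h1, hT.hull_eq, integral_triangle hT.det_ne (fun _ => 1),
    integral_refTri _ continuous_const]
  have h2 : ∫ t in (0:ℝ)..1, (1 - t) = 1 / 2 := by
    rw [intervalIntegral.integral_sub intervalIntegrable_const intervalIntegral.intervalIntegrable_id,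
      integral_id]
    norm_num
  simp only [intervalIntegral.integral_const, smul_eq_mul, mul_one, sub_zero, h2]
  ring

theorem meshSize_sq {T : Finset E2} : meshSize T ^ 2 = (volume (hull T)).toReal :=
  Real.sq_sqrt ENNReal.toReal_nonneg

theorem abs_apply_le_norm (x : E2) (i : Fin 2) : |x i| ≤ ‖x‖ := PiLp.norm_apply_le x i

/-- The gradient entries are at most `γ = δ / |det|`, where `δ` is the diameter and `|det| = 2h²`.
The area of the inscribed disc gives `ρ² ≤ 4h²`, hence `δ² ≤ 4κ²h²` and `γh ≤ κ`. -/
theorem IsTriangle.exists_baryGrad_bound {T : Finset E2} {a b c : E2} (hT : IsTriangle T a b c)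
    {κ ρ : ℝ} {z : E2} (hρ : 0 < ρ) (hz : Metric.closedBall z (ρ / 2) ⊆ hull T)
    (hd : Metric.diam (hull T) ≤ κ * ρ) :
    ∃ γ, (∀ k i, |baryGrad a b c k i| ≤ γ) ∧ γ ^ 4 * meshSize T ^ 4 ≤ κ ^ 4 := by
  have hv := hT.volume_hull
  rw [← meshSize_sq] at hv
  set h := meshSize T with hh
  have hD : 0 < |det2 (b - a) (c - a)| := abs_pos.2 hT.det_ne
  have hbd : Bornology.IsBounded (hull T) := (isCompact_hull T).isBounded
  have mem : ∀ x, x ∈ ({a, b, c} : Set E2) → x ∈ hull T := by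
    intro x hx
    rw [← hT.coe_eq] at hx
    exact hull_subset_of_mem hx
  have hba : ‖b - a‖ ≤ Metric.diam (hull T) := by
    rw [← dist_eq_norm]; exact Metric.dist_le_diam_of_mem hbd (mem b (by simp)) (mem a (by simp))
  have hca : ‖c - a‖ ≤ Metric.diam (hull T) := by
    rw [← dist_eq_norm]; exact Metric.dist_le_diam_of_mem hbd (mem c (by simp)) (mem a (by simp))
  set δ := Metric.diam (hull T) with hδ
  have hδ0 : 0 ≤ δ := Metric.diam_nonneg
  have hρh : ρ ^ 2 ≤ 4 * h ^ 2 := by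
    have h1 : volume (Metric.closedBall z (ρ / 2)) ≤ volume (hull T) := measure_mono hz
    have h2 := ENNReal.toReal_mono (isCompact_hull T).measure_lt_top.ne h1
    rw [EuclideanSpace.volume_closedBall_fin_two, ← meshSize_sq, ENNReal.toReal_mul,
      ENNReal.toReal_pow, ENNReal.toReal_ofReal (by positivity),
      ENNReal.toReal_ofReal Real.pi_pos.le] at h2
    nlinarith [Real.pi_gt_three, sq_nonneg ρ]
  have h2pos : 0 < h ^ 2 := by rw [hv]; positivity
  refine ⟨δ / |det2 (b - a) (c - a)|, ?_, ?_⟩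
  · have hb0 := (abs_apply_le_norm (b - a) 0).trans hba
    have hb1 := (abs_apply_le_norm (b - a) 1).trans hba
    have hc0 := (abs_apply_le_norm (c - a) 0).trans hca
    have hc1 := (abs_apply_le_norm (c - a) 1).trans hca
    intro k i
    fin_cases k <;> fin_cases i <;> simp only [baryGrad, Fin.zero_eta, Fin.mk_one, Matrix.of_apply,
      Matrix.cons_val', Matrix.cons_val_zero, Matrix.cons_val_one, Matrix.cons_val_fin_one,
      abs_div, abs_neg] <;> gcongr
  · have hD2 : |det2 (b - a) (c - a)| = 2 * h ^ 2 := by rw [hv]; ring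
    have h3 : δ ^ 2 ≤ κ ^ 2 * (4 * h ^ 2) := by
      calc δ ^ 2 ≤ (κ * ρ) ^ 2 := pow_le_pow_left₀ hδ0 hd 2
        _ = κ ^ 2 * ρ ^ 2 := by ring
        _ ≤ κ ^ 2 * (4 * h ^ 2) := mul_le_mul_of_nonneg_left hρh (sq_nonneg κ)
    have h4 : (δ / |det2 (b - a) (c - a)|) ^ 2 * h ^ 2 ≤ κ ^ 2 := by
      rw [hD2, div_pow, div_mul_eq_mul_div, div_le_iff₀ (by positivity)]
      nlinarith
    calc _ = ((δ / |det2 (b - a) (c - a)|) ^ 2 * h ^ 2) ^ 2 := by ring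
      _ ≤ (κ ^ 2) ^ 2 := pow_le_pow_left₀ (by positivity) h4 2
      _ = κ ^ 4 := by ring

/-! ### Zero extensions and integration by parts -/

/-- The boundary terms of the divergence theorem for `w φ` carry the factor `w`. A general smooth
`φ`, not only a polynomial, is needed to identify weak derivatives of zero extensions. -/
theorem VanishesOnEdges.integral_partialD {T : Finset E2} {a b c : E2} (hT : IsTriangle T a b c)
    {w : Poly2} (hw : VanishesOnEdges T w) {φ : E2 → ℝ} (hφ : ContDiff ℝ ∞ φ) (i : Fin 2) :
    ∫ x in hull T, pval w x * partialD i φ x =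
      -∫ x in hull T, pval (MvPolynomial.pderiv i w) x * φ x := by
  have h0 := integral_partialD_triangle hT (g := fun x => pval w x * φ x)
    (((contDiff_pval w).mul hφ).of_le (by simp)) i
  rw [Finset.sum_eq_zero] at h0
  · simp_rw [fun x => partialD_mul (differentiable_pval w x)
      (hφ.differentiable (by simp) x) i, partialD_pval] at h0
    rw [integral_add] at h0
    · linarith
    · exact ((continuous_pval _).mul hφ.continuous).integrableOn_hull T
    · exact ((continuous_pval _).mul (continuous_partialD hφ i)).integrableOn_hull T
  · intro e he
    rw [edgeMeasure, setIntegral_eq_zero_of_forall_eq_zero, mul_zero]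
    intro x hx
    rw [hw e he x hx, zero_mul]

theorem VanishesOnEdges.integral_mul_pderiv {T : Finset E2} {a b c : E2}
    (hT : IsTriangle T a b c) {w : Poly2} (hw : VanishesOnEdges T w) (p : Poly2) (i : Fin 2) :
    ∫ x in hull T, pval p x * pval (MvPolynomial.pderiv i w) x =
      -∫ x in hull T, pval (MvPolynomial.pderiv i p) x * pval w x := by
  have := hw.integral_partialD hT (contDiff_pval p) i
  simp_rw [partialD_pval] at this
  simp_rw [mul_comm (pval p _), mul_comm (pval (MvPolynomial.pderiv i p) _)]
  linarith

theorem integral_hull_sum {T : Finset E2} (F : Fin 2 → E2 → ℝ) (hF : ∀ i, Continuous (F i)) :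
    ∫ x in hull T, ∑ i, F i x = ∑ i, ∫ x in hull T, F i x :=
  integral_finsetSum _ fun i _ => (hF i).integrableOn_hull T

/-- Integration by parts for the Hessian. -/
theorem integral_frob_hess {T : Finset E2} {a b c : E2} (hT : IsTriangle T a b c)
    {v : Poly2} (hv : VanishesOnEdges T v)
    (hv' : ∀ i, VanishesOnEdges T (MvPolynomial.pderiv i v)) (τ : PWMat) :
    ∫ x in hull T, frob (matP τ T x) (matAt (hessP v) x) =
      ∫ x in hull T, divDivP τ T x * pval v x := by
  simp only [frob, matP, matAt, Matrix.of_apply, divDivP, hessP, Finset.sum_mul]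
  have hc : ∀ p q : Poly2, Continuous fun x => pval p x * pval q x :=
    fun p q => (continuous_pval p).mul (continuous_pval q)
  rw [integral_hull_sum, integral_hull_sum]
  · apply Finset.sum_congr rfl
    intro i _
    rw [integral_hull_sum _ fun j => hc _ _, integral_hull_sum _ fun j => hc _ _]
    apply Finset.sum_congr rfl
    intro j _
    -- The first integration by parts uses `∇v = 0` on the edges, the second `v = 0`.
    rw [(hv' i).integral_mul_pderiv hT, hv.integral_mul_pderiv hT, neg_neg]
  · exact fun i => continuous_finsetSum _ fun j _ => hc _ _
  · exact fun i => continuous_finsetSum _ fun j _ => hc _ _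

theorem memLp_hull {g : E2 → ℝ} (hg : Continuous g) (T : Finset E2) :
    MemLp g 2 (volume.restrict (hull T)) := by
  have : IsFiniteMeasure (volume.restrict (hull T)) :=
    ⟨by rw [Measure.restrict_apply_univ]; exact (isCompact_hull T).measure_lt_top⟩
  obtain ⟨C, hC⟩ := (isCompact_hull T).exists_bound_of_continuousOn hg.continuousOn
  apply MemLp.of_bound hg.aestronglyMeasurable C
  exact (ae_restrict_iff' (measurableSet_hull T)).2 (Filter.Eventually.of_forall hC)

namespace Mesh

variable {Ω : Set E2} (K : Mesh Ω)

theorem integral_indicator_hull (hΩ : IsPlateDomain Ω) {T : Finset E2} (hT : T ∈ K.tri)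
    (g : E2 → ℝ) : ∫ x in Ω, (hull T).indicator g x = ∫ x in hull T, g x := by
  rw [setIntegral_indicator (measurableSet_hull T)]
  apply setIntegral_congr_set
  rw [ae_eq_set]
  refine ⟨by rw [Set.sdiff_eq_empty.2 Set.inter_subset_right, measure_empty], ?_⟩
  have : hull T \ (Ω ∩ hull T) = hull T \ Ω := by ext x; simp
  rw [this]
  exact K.hull_ae_le hΩ hT

/-- Since `w` vanishes on `∂T`, cutting it off creates no singular part in its derivative. Applied
to `v` and then to `∂ᵢv`, this gives `H²`. -/
theorem isH1_indicator (hΩ : IsPlateDomain Ω) {T : Finset E2} (hT : T ∈ K.tri) {w : Poly2}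
    (hw : VanishesOnEdges T w) :
    IsH1 Ω ((hull T).indicator (pval w))
      (fun i => (hull T).indicator (pval (MvPolynomial.pderiv i w))) := by
  obtain ⟨a, b, c, h⟩ := K.exists_isTriangle hT
  have hm : ∀ q : Poly2, MemLp ((hull T).indicator (pval q)) 2 (volume.restrict Ω) := by
    intro q
    rw [memLp_indicator_iff_restrict (measurableSet_hull T),
      Measure.restrict_restrict (measurableSet_hull T)]
    exact (memLp_hull (continuous_pval q) T).mono_measure
      (Measure.restrict_mono Set.inter_subset_left le_rfl)
  refine ⟨hm w, fun i => ⟨hm _, ?_⟩⟩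
  intro φ hφ _
  simp_rw [← Set.indicator_mul_left (hull T) (pval w),
    ← Set.indicator_mul_left (hull T) (pval (MvPolynomial.pderiv i w))]
  rw [K.integral_indicator_hull hΩ hT, K.integral_indicator_hull hΩ hT]
  exact hw.integral_partialD h hφ.1 i

/-- The zero extension of a polynomial that vanishes to first order on the boundary of a triangle
belongs to the energy space. -/
theorem isEnergyFn_indicator (hΩ : IsPlateDomain Ω) (Γc Γs : Set E2) {T : Finset E2}
    (hT : T ∈ K.tri) {v : Poly2} (hv : VanishesOnEdges T v)
    (hv' : ∀ i, VanishesOnEdges T (MvPolynomial.pderiv i v)) :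
    IsEnergyFn Ω Γc Γs ((hull T).indicator (pval v))
      (fun i => (hull T).indicator (pval (MvPolynomial.pderiv i v)))
      (fun i j => (hull T).indicator (hessP v i j)) := by
  obtain ⟨a, b, c, h⟩ := K.exists_isTriangle hT
  refine ⟨⟨K.isH1_indicator hΩ hT hv, fun i => K.isH1_indicator hΩ hT (hv' i)⟩, ?_, ?_⟩
  -- Both boundary conditions hold for every test function, wherever its support is: the integrand
  -- is a sum of derivatives of products that vanish on `∂T`.
  · intro i φ hφ _
    have e : ∀ x, (hull T).indicator (pval v) x * partialD i φ x +
        (hull T).indicator (pval (MvPolynomial.pderiv i v)) x * φ x =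
        (hull T).indicator (fun x => pval v x * partialD i φ x +
          pval (MvPolynomial.pderiv i v) x * φ x) x := by
      intro x
      by_cases hx : x ∈ hull T <;> simp [hx]
    simp_rw [e]
    rw [K.integral_indicator_hull hΩ hT, integral_add, hv.integral_partialD h hφ.1 i]
    · ring
    · exact ((continuous_pval _).mul (continuous_partialD hφ.1 i)).integrableOn_hull T
    · exact ((continuous_pval _).mul hφ.1.continuous).integrableOn_hull T
  · intro φ hφ _
    have e : ∀ x, (∑ i, (hull T).indicator (hessP v i i) x) * φ x +
        ∑ i, (hull T).indicator (pval (MvPolynomial.pderiv i v)) x * partialD i φ x =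
        (hull T).indicator (fun x => ∑ i, (hessP v i i x * φ x +
          pval (MvPolynomial.pderiv i v) x * partialD i φ x)) x := by
      intro x
      by_cases hx : x ∈ hull T
      · simp only [Set.indicator_of_mem hx, Finset.sum_mul, Finset.sum_add_distrib]
      · simp [hx]
    simp_rw [e]
    have i1 : ∀ i, Continuous fun x => hessP v i i x * φ x :=
      fun i => (continuous_pval _).mul hφ.1.continuous
    have i2 : ∀ i, Continuous fun x => pval (MvPolynomial.pderiv i v) x * partialD i φ x :=
      fun i => (continuous_pval _).mul (continuous_partialD hφ.1 i)
    rw [K.integral_indicator_hull hΩ hT, integral_hull_sum (fun i x => hessP v i i x * φ x +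
        pval (MvPolynomial.pderiv i v) x * partialD i φ x) fun i => (i1 i).add (i2 i)]
    apply Finset.sum_eq_zero
    intro i _
    rw [integral_add ((i1 i).integrableOn_hull T) ((i2 i).integrableOn_hull T),
      (hv' i).integral_partialD h hφ.1 i]
    exact add_neg_cancel _

/-- The equilibrium equation tested with a bubble function. -/
theorem integral_frob_moment_hess (hΩ : IsPlateDomain Ω) {Γc Γs : Set E2} {Ey d ν : ℝ}
    {f u : E2 → ℝ} {Du : Fin 2 → E2 → ℝ} {D2u : Fin 2 → Fin 2 → E2 → ℝ}
    (hu : IsPlateSolution Ω Γc Γs Ey d ν f u Du D2u) {T : Finset E2}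
    (hT : T ∈ K.tri) {v : Poly2} (hv : VanishesOnEdges T v)
    (hv' : ∀ i, VanishesOnEdges T (MvPolynomial.pderiv i v)) :
    ∫ x in hull T, frob (moment Ey d ν (matAt D2u x)) (matAt (hessP v) x) =
      ∫ x in hull T, f x * pval v x := by
  have := hu.2 _ _ _ (K.isEnergyFn_indicator hΩ Γc Γs hT hv hv')
  have e1 : ∀ x, frob (moment Ey d ν (matAt D2u x))
      (matAt (fun i j => (hull T).indicator (hessP v i j)) x) =
      (hull T).indicator (fun x => frob (moment Ey d ν (matAt D2u x)) (matAt (hessP v) x)) x := by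
    intro x
    by_cases hx : x ∈ hull T <;> simp [hx, frob, matAt]
  simp_rw [e1, ← Set.indicator_mul_right (hull T) f] at this
  rwa [K.integral_indicator_hull hΩ hT, K.integral_indicator_hull hΩ hT] at this

end Mesh

/-! ### Frobenius products -/

theorem memLp_moment {μ : Measure E2} {A : Fin 2 → Fin 2 → E2 → ℝ} (hA : ∀ i j, MemLp (A i j) 2 μ)
    (Ey d ν : ℝ) (i j : Fin 2) : MemLp (fun x => moment Ey d ν (matAt A x) i j) 2 μ := by
  have h : (fun x => moment Ey d ν (matAt A x) i j) = fun x =>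
      (Ey * d ^ 3 / (12 * (1 - ν ^ 2))) * ((1 - ν) * A i j x +
        (ν * (1 : Matrix (Fin 2) (Fin 2) ℝ) i j) * (A 0 0 x + A 1 1 x)) := by
    funext x
    simp [moment, matAt, Matrix.trace, Fin.sum_univ_two]
    left; ring
  rw [h]
  exact (((hA i j).const_mul _).add (((hA 0 0).add (hA 1 1)).const_mul _)).const_mul _

theorem integrable_frob {μ : Measure E2} {A B : E2 → Matrix (Fin 2) (Fin 2) ℝ}
    (hA : ∀ i j, MemLp (fun x => A x i j) 2 μ) (hB : ∀ i j, MemLp (fun x => B x i j) 2 μ) :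
    Integrable (fun x => frob (A x) (B x)) μ :=
  integrable_finsetSum _ fun i _ => integrable_finsetSum _ fun j _ =>
    (hA i j).integrable_mul (hB i j)

theorem frob_self_nonneg (A : Matrix (Fin 2) (Fin 2) ℝ) : 0 ≤ frob A A :=
  Finset.sum_nonneg fun _ _ => Finset.sum_nonneg fun _ _ => mul_self_nonneg _

/-- The difference of the two sides is a square. The free weight `ε` allows the bubble terms to be
absorbed without square roots of integrals. -/
theorem mul_le_young {ε : ℝ} (hε : 0 < ε) (x y : ℝ) :
    x * y ≤ (4 * ε)⁻¹ * (x * x) + ε * (y * y) := by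
  have h : (4 * ε)⁻¹ * (x * x) + ε * (y * y) - x * y = (4 * ε)⁻¹ * (x - 2 * ε * y) ^ 2 := by
    field_simp; ring
  have : 0 ≤ (4 * ε)⁻¹ * (x - 2 * ε * y) ^ 2 := by positivity
  linarith

theorem frob_le_young {ε : ℝ} (hε : 0 < ε) (A B : Matrix (Fin 2) (Fin 2) ℝ) :
    frob A B ≤ (4 * ε)⁻¹ * frob A A + ε * frob B B := by
  simp only [frob, Fin.sum_univ_two]
  have h1 := mul_le_young hε (A 0 0) (B 0 0)
  have h2 := mul_le_young hε (A 0 1) (B 0 1)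
  have h3 := mul_le_young hε (A 1 0) (B 1 0)
  have h4 := mul_le_young hε (A 1 1) (B 1 1)
  linarith

theorem frob_add_self_le (A B : Matrix (Fin 2) (Fin 2) ℝ) :
    frob (A + B) (A + B) ≤ 2 * frob A A + 2 * frob B B := by
  simp only [frob, Fin.sum_univ_two, Matrix.add_apply]
  nlinarith [sq_nonneg (A 0 0 - B 0 0), sq_nonneg (A 0 1 - B 0 1), sq_nonneg (A 1 0 - B 1 0),
    sq_nonneg (A 1 1 - B 1 1)]

/-- Uniformity in `ν`: the square expands to `(1 + ν)²|A|² - 2ν (tr A)²`, where the trace term has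
the favourable sign and `(1 + ν)² ≤ 9/4 ≤ 3`. -/
theorem frob_momentInv_le {Ey d ν : ℝ} (h0 : 0 ≤ ν) (h1 : ν < 1 / 2)
    (A : Matrix (Fin 2) (Fin 2) ℝ) :
    frob (momentInv Ey d ν A) (momentInv Ey d ν A) ≤ 3 * (12 / (Ey * d ^ 3)) ^ 2 * frob A A := by
  have e : frob (momentInv Ey d ν A) (momentInv Ey d ν A) =
      (12 / (Ey * d ^ 3)) ^ 2 * ((1 + ν) ^ 2 * frob A A - 2 * ν * A.trace ^ 2) := by
    generalize hc : 12 / (Ey * d ^ 3) = m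
    simp [frob, momentInv, Fin.sum_univ_two, Matrix.trace, hc]
    ring
  rw [e]
  have hA := frob_self_nonneg A
  have h2 : (1 + ν) ^ 2 * frob A A - 2 * ν * A.trace ^ 2 ≤ 3 * frob A A := by
    have : (1 + ν) ^ 2 ≤ 3 := by nlinarith
    have h3 : 0 ≤ 2 * ν * A.trace ^ 2 := by positivity
    nlinarith
  calc _ ≤ (12 / (Ey * d ^ 3)) ^ 2 * (3 * frob A A) := mul_le_mul_of_nonneg_left h2 (sq_nonneg _)
    _ = _ := by ring

/-! ### Efficiency of the element residual -/

theorem MemLp.integrable_fun_mul {μ : Measure E2} {f g : E2 → ℝ} (hf : MemLp f 2 μ)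
    (hg : MemLp g 2 μ) : Integrable (fun x => f x * g x) μ :=
  hf.integrable_mul hg

theorem continuous_divDivP (τ : PWMat) (T : Finset E2) : Continuous (divDivP τ T) := by
  unfold divDivP
  exact continuous_finsetSum _ fun i _ => continuous_finsetSum _ fun j _ => continuous_pval _

theorem pval_sub_divDiv (q : Poly2) (τ : PWMat) (T : Finset E2) (x : E2) :
    pval (q - ∑ i, ∑ j, MvPolynomial.pderiv i (MvPolynomial.pderiv j (τ T i j))) x =
      pval q x - divDivP τ T x := by
  simp only [pval_sub, pval_sum, divDivP]

theorem totalDegree_sub_divDiv_le {r : ℕ} {q : Poly2} {τ : PWMat} {T : Finset E2}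
    (hq : q.totalDegree ≤ r) (hτ : ∀ i j, (τ T i j).totalDegree ≤ r - 1) :
    (q - ∑ i, ∑ j, MvPolynomial.pderiv i (MvPolynomial.pderiv j (τ T i j))).totalDegree ≤ r := by
  rw [← MvPolynomial.mem_restrictTotalDegree]
  refine Submodule.sub_mem _ ((MvPolynomial.mem_restrictTotalDegree _ _ _).2 hq)
    (Submodule.sum_mem _ fun i _ => Submodule.sum_mem _ fun j _ => ?_)
  rw [MvPolynomial.mem_restrictTotalDegree]
  exact ((totalDegree_pderiv_le _ _).trans (totalDegree_pderiv_le _ _)).trans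
    ((hτ i j).trans (Nat.sub_le _ _))

theorem IsTriangle.meshSize_pos {T : Finset E2} {a b c : E2} (hT : IsTriangle T a b c) :
    0 < meshSize T := by
  rw [meshSize, Real.sqrt_pos, hT.volume_hull]
  have := abs_pos.2 hT.det_ne
  positivity

theorem integral_frob_hess_le {T : Finset E2} {v : Poly2} {c : ℝ}
    (h : ∀ i j, ∫ x in hull T, hessP v i j x ^ 2 ≤ c) :
    ∫ x in hull T, frob (matAt (hessP v) x) (matAt (hessP v) x) ≤ 4 * c := by
  have hc : ∀ i j, Continuous fun x => hessP v i j x * hessP v i j x :=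
    fun i j => (continuous_pval _).mul (continuous_pval _)
  simp only [frob, matAt, Matrix.of_apply]
  rw [integral_hull_sum (fun i x => ∑ j, hessP v i j x * hessP v i j x)
      fun i => continuous_finsetSum _ fun j _ => hc i j]
  rw [Finset.sum_congr rfl fun i _ => integral_hull_sum
    (fun j x => hessP v i j x * hessP v i j x) (hc i)]
  simp only [Fin.sum_univ_two, ← sq]
  linarith [h 0 0, h 0 1, h 1 0, h 1 1]

/-- The bubble argument: `f - div div σh` is split into the data error `f - q` and the polynomial `p
= q - div div σh`, to which `exists_bubble` applies. In `N = ∫ p v` the unknown `σ` enters through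
the plate equation. -/
theorem Mesh.exists_residual_bound (r : ℕ) (κ : ℝ) : ∃ C : ℝ, 0 < C ∧
    ∀ {Ω Γc Γs : Set E2} {Ey d ν : ℝ} {f u : E2 → ℝ} {Du : Fin 2 → E2 → ℝ}
      {D2u : Fin 2 → Fin 2 → E2 → ℝ} (K : Mesh Ω), IsPlateDomain Ω →
      MemLp f 2 (volume.restrict Ω) → IsPlateSolution Ω Γc Γs Ey d ν f u Du D2u →
      K.ShapeRegular κ → ∀ T ∈ K.tri, ∀ (σh : PWMat) (q : Poly2),
      (∀ i j, (σh T i j).totalDegree ≤ r - 1) → q.totalDegree ≤ r →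
      meshSize T ^ 4 * ∫ x in hull T, (f x - divDivP σh T x) ^ 2 ≤
        C * ((∫ x in hull T, frob (moment Ey d ν (matAt D2u x) - matP σh T x)
            (moment Ey d ν (matAt D2u x) - matP σh T x)) +
          meshSize T ^ 4 * ∫ x in hull T, (f x - pval q x) ^ 2) := by
  obtain ⟨C, hC, hb⟩ := exists_bubble r
  refine ⟨2 + 16 * C ^ 2 * (κ ^ 4 + 1), by positivity, ?_⟩
  intro Ω Γc Γs Ey d ν f u Du D2u K hΩ hf hu hκ T hT σh q hσ hq
  obtain ⟨a, b, c, h⟩ := K.exists_isTriangle hT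
  have hle := K.restrict_hull_le hΩ hT
  have hfT : MemLp f 2 (volume.restrict (hull T)) := hf.mono_measure hle
  have hD2u : ∀ i j, MemLp (D2u i j) 2 (volume.restrict (hull T)) :=
    fun i j => ((hu.1.1.2 i).2 j).1.mono_measure hle
  obtain ⟨z, ρ, hρ, hz, hd⟩ := hκ T hT
  obtain ⟨γ, hγ, hγκ⟩ := h.exists_baryGrad_bound hρ hz hd
  obtain ⟨v, hv, hv', hN0, hp2, hv2, hH⟩ := hb T a b c h _ (totalDegree_sub_divDiv_le hq hσ)
  simp only [pval_sub_divDiv] at hN0 hp2 hv2 hH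
  have hhess := integral_frob_hess_le (hH γ hγ)
  set N := ∫ x in hull T, (pval q x - divDivP σh T x) * pval v x
  set η := meshSize T
  have hη : 0 < η := h.meshSize_pos
  set S : E2 → Matrix (Fin 2) (Fin 2) ℝ :=
    fun x => moment Ey d ν (matAt D2u x) - matP σh T x with hS
  set H : E2 → Matrix (Fin 2) (Fin 2) ℝ := fun x => matAt (hessP v) x with hHdef
  have mM : ∀ i j, MemLp (fun x => moment Ey d ν (matAt D2u x) i j) 2 (volume.restrict (hull T)) :=
    memLp_moment hD2u Ey d ν
  have mσ : ∀ i j, MemLp (fun x => matP σh T x i j) 2 (volume.restrict (hull T)) :=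
    fun i j => memLp_hull (continuous_pval (σh T i j)) T
  have mS : ∀ i j, MemLp (fun x => S x i j) 2 (volume.restrict (hull T)) :=
    fun i j => (mM i j).sub (mσ i j)
  have mH : ∀ i j, MemLp (fun x => H x i j) 2 (volume.restrict (hull T)) :=
    fun i j => memLp_hull (continuous_pval _) T
  have mq := memLp_hull (continuous_pval q) T
  have mv := memLp_hull (continuous_pval v) T
  have mdd := memLp_hull (continuous_divDivP σh T) T
  have mfq : MemLp (fun x => pval q x - f x) 2 (volume.restrict (hull T)) := mq.sub hfT
  set A := ∫ x in hull T, (f x - pval q x) ^ 2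
  set Sg := ∫ x in hull T, frob (S x) (S x)
  have hAeq : ∫ x in hull T, (pval q x - f x) * (pval q x - f x) = A := by
    congr 1; funext x; ring
  have hSg0 : 0 ≤ Sg := integral_nonneg fun x => frob_self_nonneg _
  have hA0 : 0 ≤ A := integral_nonneg fun x => sq_nonneg _
  -- the bubble identity
  have hN : N = (∫ x in hull T, (pval q x - f x) * pval v x) + ∫ x in hull T, frob (S x) (H x) := by
    -- The plate equation handles `σ`, elementwise integration by parts handles `σh`.
    have e1 : ∫ x in hull T, frob (S x) (H x) = (∫ x in hull T, f x * pval v x) -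
        ∫ x in hull T, divDivP σh T x * pval v x := by
      rw [← K.integral_frob_moment_hess hΩ hu hT hv hv', ← integral_frob_hess h hv hv' σh,
        ← integral_sub (integrable_frob mM mH) (integrable_frob mσ mH)]
      congr 1; funext x
      simp only [hS, hHdef, frob, Matrix.sub_apply, Fin.sum_univ_two]
      ring
    have e2 : N = (∫ x in hull T, (pval q x - f x) * pval v x) +
        ((∫ x in hull T, f x * pval v x) - ∫ x in hull T, divDivP σh T x * pval v x) := by
      have i1 := MemLp.integrable_fun_mul hfT mv
      have i2 := MemLp.integrable_fun_mul mdd mv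
      have i3 : Integrable (fun x => f x * pval v x - divDivP σh T x * pval v x)
        (volume.restrict (hull T)) := i1.sub i2
      rw [← integral_sub i1 i2, ← integral_add (MemLp.integrable_fun_mul mfq mv) i3]
      refine integral_congr_ae (Filter.Eventually.of_forall fun x => ?_)
      simp only
      ring
    rw [e1, e2]
  have hY1 : ∀ ε : ℝ, 0 < ε → ∫ x in hull T, (pval q x - f x) * pval v x ≤
      (4 * ε)⁻¹ * A + ε * ∫ x in hull T, pval v x ^ 2 := by
    intro ε hε
    simp_rw [sq (pval v _)]
    rw [← hAeq, ← integral_const_mul, ← integral_const_mul, ← integral_add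
      ((MemLp.integrable_fun_mul mfq mfq).const_mul _) ((MemLp.integrable_fun_mul mv mv).const_mul _)]
    exact integral_mono (MemLp.integrable_fun_mul mfq mv)
      (((MemLp.integrable_fun_mul mfq mfq).const_mul _).add ((MemLp.integrable_fun_mul mv mv).const_mul _))
      fun x => mul_le_young hε _ _
  have hY2 : ∀ ε : ℝ, 0 < ε → ∫ x in hull T, frob (S x) (H x) ≤
      (4 * ε)⁻¹ * Sg + ε * ∫ x in hull T, frob (H x) (H x) := by
    intro ε hε
    rw [← integral_const_mul, ← integral_const_mul, ← integral_add
      ((integrable_frob mS mS).const_mul _) ((integrable_frob mH mH).const_mul _)]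
    exact integral_mono (integrable_frob mS mH)
      (((integrable_frob mS mS).const_mul _).add ((integrable_frob mH mH).const_mul _))
      fun x => frob_le_young hε _ _
  have hNle : η ^ 4 * N ≤ 2 * C * (η ^ 4 * A) + 8 * C * (κ ^ 4 + 1) * Sg := by
    have hκ0 : 0 < κ ^ 4 + 1 := by positivity
    -- The two Young weights are chosen so that each bubble term is at most `N / 4`, which leaves `N
    -- / 2` on the left. The second contains `η ^ 4`, against which `γ ^ 4` is measured; the `1` in
    -- `κ ^ 4 + 1` keeps the denominator positive for every real `κ`.
    have h1 := hY1 (4 * C)⁻¹ (by positivity)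
    have h2 := hY2 (η ^ 4 / (16 * C * (κ ^ 4 + 1))) (by positivity)
    have h3 : (4 * C)⁻¹ * ∫ x in hull T, pval v x ^ 2 ≤ N / 4 := by
      calc _ ≤ (4 * C)⁻¹ * (C * N) := mul_le_mul_of_nonneg_left hv2 (by positivity)
        _ = N / 4 := by field_simp
    have h4 : η ^ 4 / (16 * C * (κ ^ 4 + 1)) * ∫ x in hull T, frob (H x) (H x) ≤ N / 4 := by
      calc _ ≤ η ^ 4 / (16 * C * (κ ^ 4 + 1)) * (4 * (C * γ ^ 4 * N)) :=
            mul_le_mul_of_nonneg_left hhess (by positivity)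
        _ = (γ ^ 4 * η ^ 4) / (κ ^ 4 + 1) * (N / 4) := by field_simp; ring
        _ ≤ 1 * (N / 4) := by
          apply mul_le_mul_of_nonneg_right _ (by positivity)
          rw [div_le_one hκ0]; linarith
        _ = N / 4 := one_mul _
    have e1 : (4 * (4 * C)⁻¹)⁻¹ = C := by field_simp
    have e2 : η ^ 4 * ((4 * (η ^ 4 / (16 * C * (κ ^ 4 + 1))))⁻¹ * Sg) =
        4 * C * (κ ^ 4 + 1) * Sg := by field_simp; ring
    rw [e1] at h1
    have h5 : N / 2 ≤ C * A + (4 * (η ^ 4 / (16 * C * (κ ^ 4 + 1))))⁻¹ * Sg := by linarith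
    have h6 := mul_le_mul_of_nonneg_left h5 (show 0 ≤ η ^ 4 by positivity)
    rw [mul_add, e2] at h6
    linarith
  have hp : ∫ x in hull T, (f x - divDivP σh T x) ^ 2 ≤ 2 * A + 2 * (C * N) := by
    have mp : MemLp (fun x => pval q x - divDivP σh T x) 2 (volume.restrict (hull T)) := mq.sub mdd
    have mfd : MemLp (fun x => f x - divDivP σh T x) 2 (volume.restrict (hull T)) := hfT.sub mdd
    have mfq' : MemLp (fun x => f x - pval q x) 2 (volume.restrict (hull T)) := hfT.sub mq
    refine le_trans ?_ (add_le_add_right (mul_le_mul_of_nonneg_left hp2 zero_le_two) _)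
    rw [← integral_const_mul, ← integral_const_mul, ← integral_add
      (mfq'.integrable_sq.const_mul _) (mp.integrable_sq.const_mul _)]
    refine integral_mono mfd.integrable_sq
      ((mfq'.integrable_sq.const_mul _).add (mp.integrable_sq.const_mul _)) fun x => ?_
    simp only
    nlinarith [sq_nonneg (f x - pval q x - (pval q x - divDivP σh T x))]
  have hη4 : 0 ≤ η ^ 4 := by positivity
  have hηA : 0 ≤ η ^ 4 * A := mul_nonneg hη4 hA0
  calc η ^ 4 * ∫ x in hull T, (f x - divDivP σh T x) ^ 2 ≤ η ^ 4 * (2 * A + 2 * (C * N)) :=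
        mul_le_mul_of_nonneg_left hp hη4
    _ = 2 * (η ^ 4 * A) + 2 * C * (η ^ 4 * N) := by ring
    _ ≤ 2 * (η ^ 4 * A) + 2 * C * (2 * C * (η ^ 4 * A) + 8 * C * (κ ^ 4 + 1) * Sg) := by
        have := mul_le_mul_of_nonneg_left hNle (show 0 ≤ 2 * C by positivity)
        linarith
    _ = (2 + 4 * C ^ 2) * (η ^ 4 * A) + (16 * C ^ 2 * (κ ^ 4 + 1)) * Sg := by ring
    _ ≤ (2 + 16 * C ^ 2 * (κ ^ 4 + 1)) * (η ^ 4 * A) +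
        (2 + 16 * C ^ 2 * (κ ^ 4 + 1)) * Sg := by
        apply add_le_add
        · apply mul_le_mul_of_nonneg_right _ hηA
          have : 0 ≤ C ^ 2 * κ ^ 4 := by positivity
          nlinarith [sq_nonneg C]
        · apply mul_le_mul_of_nonneg_right _ hSg0
          linarith
    _ = _ := by ring

/-! ### Efficiency of the consistency term -/

theorem momentInv_sub (Ey d ν : ℝ) (A B : Matrix (Fin 2) (Fin 2) ℝ) :
    momentInv Ey d ν (A - B) = momentInv Ey d ν A - momentInv Ey d ν B := by
  ext i j
  simp [momentInv, Matrix.trace, Fin.sum_univ_two]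
  ring

theorem frob_neg_neg (A : Matrix (Fin 2) (Fin 2) ℝ) : frob (-A) (-A) = frob A A := by
  simp [frob]

/-- Insert `𝕄⁻¹σ = ∇²u`. The factor `6` is `2` from squaring a sum times `3` from
`frob_momentInv_le`. -/
theorem integral_consistency_le {Ey d ν : ℝ} (hEy : 0 < Ey) (hd : 0 < d) (h0 : 0 ≤ ν)
    (h1 : ν < 1 / 2) {T : Finset E2} {D2u : Fin 2 → Fin 2 → E2 → ℝ}
    (hD2u : ∀ i j, MemLp (D2u i j) 2 (volume.restrict (hull T))) (σh : PWMat) (v : Poly2) :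
    ∫ x in hull T, frob (momentInv Ey d ν (matP σh T x) - matAt (hessP v) x)
        (momentInv Ey d ν (matP σh T x) - matAt (hessP v) x) ≤
      6 * (12 / (Ey * d ^ 3)) ^ 2 *
        (∫ x in hull T, frob (moment Ey d ν (matAt D2u x) - matP σh T x)
          (moment Ey d ν (matAt D2u x) - matP σh T x)) +
      2 * ∫ x in hull T, frob (matAt (fun i j x => D2u i j x - hessP v i j x) x)
        (matAt (fun i j x => D2u i j x - hessP v i j x) x) := by
  have mσ : ∀ i j, MemLp (fun x => matP σh T x i j) 2 (volume.restrict (hull T)) :=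
    fun i j => memLp_hull (continuous_pval (σh T i j)) T
  have mS : ∀ i j, MemLp (fun x => (moment Ey d ν (matAt D2u x) - matP σh T x) i j) 2
      (volume.restrict (hull T)) := fun i j => (memLp_moment hD2u Ey d ν i j).sub (mσ i j)
  have mE : ∀ i j, MemLp (fun x => (matAt (fun i j x => D2u i j x - hessP v i j x) x) i j) 2
      (volume.restrict (hull T)) := fun i j =>
    (hD2u i j).sub (memLp_hull (continuous_pval _) T)
  rw [← integral_const_mul, ← integral_const_mul, ← integral_add
    ((integrable_frob mS mS).const_mul _) ((integrable_frob mE mE).const_mul _)]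
  apply integral_mono_of_nonneg (Filter.Eventually.of_forall fun x => frob_self_nonneg _)
    (((integrable_frob mS mS).const_mul _).add ((integrable_frob mE mE).const_mul _))
  refine Filter.Eventually.of_forall fun x => ?_
  have e : momentInv Ey d ν (matP σh T x) - matAt (hessP v) x =
      -momentInv Ey d ν (moment Ey d ν (matAt D2u x) - matP σh T x) +
        matAt (fun i j x => D2u i j x - hessP v i j x) x := by
    rw [momentInv_sub, (moment_momentInv hEy hd h0 h1 (matAt D2u x)).2]
    ext i j
    simp [matAt]
  simp only [Pi.add_apply]
  rw [e]
  refine (frob_add_self_le _ _).trans ?_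
  rw [frob_neg_neg]
  have := frob_momentInv_le (Ey := Ey) (d := d) h0 h1
    (moment Ey d ν (matAt D2u x) - matP σh T x)
  linarith

open scoped Classical in
theorem mem_jumpEdges {Ω Γc : Set E2} {T e : Finset E2} :
    e ∈ jumpEdges Ω Γc T ↔ e ∈ triEdges T ∧ (openEdge e ⊆ Ω ∨ openEdge e ⊆ Γc) :=
  Finset.mem_filter

theorem theorem3p3 (Ω : Set E2) (hΩ : IsPlateDomain Ω) (Ey d : ℝ) (hEy : 0 < Ey) (hd : 0 < d)
    (r : ℕ) (hr : 1 ≤ r) (κ : ℝ) :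
    ∃ C : ℝ, 0 < C ∧
      ∀ (ν : ℝ), 0 ≤ ν → ν < 1 / 2 →
      ∀ (Γc Γs Γf : Set E2), IsBoundarySplitting Ω Γc Γs Γf →
      ∀ (f : E2 → ℝ), MemLp f 2 (volume.restrict Ω) →
      ∀ (u : E2 → ℝ) (Du : Fin 2 → E2 → ℝ) (D2u : Fin 2 → Fin 2 → E2 → ℝ),
        IsPlateSolution Ω Γc Γs Ey d ν f u Du D2u →
      ∀ (K : Mesh Ω), K.Resolves Γc Γs Γf → K.ShapeRegular κ →
      ∀ (σh : PWMat) (uh wh : PW),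
        K.IsHHJSolution Γc Γs Γf Ey d ν r f σh uh →
        K.IsCorrection Γc Γs Ey d ν r σh uh wh →
      ∀ (Qf : PW), K.IsL2Projection r f Qf →
      ∀ T ∈ K.tri,
        K.estimator Γc Ey d ν f σh (uh + wh) T ≤
          C * (momentError Ey d ν D2u σh T +
            K.deflectionError Γc Du D2u (uh + wh) T +
            meshSize T ^ 2 * Real.sqrt (∫ x in hull T, (f x - pval (Qf T) x) ^ 2)) := by
  obtain ⟨C, hC, hres⟩ := Mesh.exists_residual_bound r κ
  set m := (12 / (Ey * d ^ 3)) ^ 2 with hm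
  -- `6 * m` and `2` come from the consistency term, `C` from the residual; the jumps need only `1`.
  -- None of these involves `ν`.
  refine ⟨6 * m + C + 2, by positivity, ?_⟩
  intro ν h0 h1 Γc Γs Γf _ f hf u Du D2u hu K _ hκ σh uh wh hsol _ Qf hQ T hT
  have hle := K.restrict_hull_le hΩ hT
  have hD2u : ∀ i j, MemLp (D2u i j) 2 (volume.restrict (hull T)) :=
    fun i j => ((hu.1.1.2 i).2 j).1.mono_measure hle
  have hR := hres K hΩ hf hu hκ T hT σh (Qf T) (fun i j => (hsol.1.1 T hT i j).2) (hQ T hT).1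
  have hA := integral_consistency_le hEy hd h0 h1 hD2u σh ((uh + wh) T)
  have hJ : ∀ e ∈ jumpEdges Ω Γc T,
      ∫ x, (K.normalJump (fun T' i x => Du i x - pval (MvPolynomial.pderiv i ((uh + wh) T')) x)
        (fun T' i j x => D2u i j x - hessP ((uh + wh) T') i j x) e x) ^ 2 ∂(edgeMeasure e) =
      ∫ x, (K.jumpP (uh + wh) e x) ^ 2 ∂(edgeMeasure e) := by
    intro e he
    have he := mem_jumpEdges.1 he
    exact K.integral_normalJump_sq hΩ (fun i => (hu.1.1.1.2 i).1)
      (fun i j => ((hu.1.1.2 i).2 j).1) hu.1.2.2 (uh + wh) ⟨T, hT, he.1⟩ he.2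
  rw [Mesh.estimator, Mesh.deflectionError, Mesh.norm2h,
    Finset.sum_congr rfl fun e he => congrArg _ (hJ e he), momentError]
  have hJ0 : 0 ≤ ∑ e ∈ jumpEdges Ω Γc T,
      (edgeLen e)⁻¹ * ∫ x, (K.jumpP (uh + wh) e x) ^ 2 ∂(edgeMeasure e) :=
    Finset.sum_nonneg fun e _ => mul_nonneg (inv_nonneg.2 Metric.diam_nonneg)
      (integral_nonneg fun x => sq_nonneg _)
  have hSg0 : 0 ≤ ∫ x in hull T, frob (moment Ey d ν (matAt D2u x) - matP σh T x)
      (moment Ey d ν (matAt D2u x) - matP σh T x) := integral_nonneg fun x => frob_self_nonneg _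
  have hE0 : 0 ≤ ∫ x in hull T,
      frob (matAt (fun i j x => D2u i j x - hessP ((uh + wh) T) i j x) x)
        (matAt (fun i j x => D2u i j x - hessP ((uh + wh) T) i j x) x) :=
    integral_nonneg fun x => frob_self_nonneg _
  have hQ0 : 0 ≤ ∫ x in hull T, (f x - pval (Qf T) x) ^ 2 := integral_nonneg fun x => sq_nonneg _
  generalize (∑ e ∈ jumpEdges Ω Γc T,
      (edgeLen e)⁻¹ * ∫ x, (K.jumpP (uh + wh) e x) ^ 2 ∂(edgeMeasure e)) = J at *
  generalize (∫ x in hull T, frob (moment Ey d ν (matAt D2u x) - matP σh T x)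
      (moment Ey d ν (matAt D2u x) - matP σh T x)) = S at *
  generalize (∫ x in hull T,
      frob (matAt (fun i j x => D2u i j x - hessP ((uh + wh) T) i j x) x)
        (matAt (fun i j x => D2u i j x - hessP ((uh + wh) T) i j x) x)) = E at *
  generalize (∫ x in hull T, (f x - pval (Qf T) x) ^ 2) = A at *
  have hs1 := Real.sq_sqrt hSg0
  have hs2 := Real.sq_sqrt (add_nonneg hE0 hJ0)
  have hs3 := Real.sq_sqrt hQ0
  have hn1 := Real.sqrt_nonneg S
  have hn2 := Real.sqrt_nonneg (E + J)
  have hn3 := mul_nonneg (sq_nonneg (meshSize T)) (Real.sqrt_nonneg A)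
  have hm0 : 0 ≤ m := sq_nonneg _
  set s := Real.sqrt S + Real.sqrt (E + J) + meshSize T ^ 2 * Real.sqrt A with hs
  have hs0 : 0 ≤ s := by positivity
  -- A sum of squares of nonnegative numbers is at most the square of their sum.
  have hsum : S + (E + J) + meshSize T ^ 4 * A ≤ s ^ 2 := by
    rw [← hs1, ← hs2, ← hs3, hs]
    rw [show meshSize T ^ 4 * Real.sqrt A ^ 2 = (meshSize T ^ 2 * Real.sqrt A) ^ 2 by ring]
    nlinarith [mul_nonneg hn1 hn2, mul_nonneg hn1 hn3, mul_nonneg hn2 hn3]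
  have hhA : 0 ≤ meshSize T ^ 4 * A := by positivity
  refine Real.sqrt_le_iff.2 ⟨by positivity, ?_⟩
  calc _ ≤ (6 * m + C + 2) * (S + (E + J) + meshSize T ^ 4 * A) := by
        have k1 : 0 ≤ m * (E + J + meshSize T ^ 4 * A) := by positivity
        have k2 : 0 ≤ C * (E + J) := by positivity
        nlinarith
    _ ≤ (6 * m + C + 2) * s ^ 2 := mul_le_mul_of_nonneg_left hsum (by positivity)
    -- The constant is at least one, so it may be squared to match the square root in the estimator.
    _ ≤ (6 * m + C + 2) ^ 2 * s ^ 2 := by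
        apply mul_le_mul_of_nonneg_right _ (sq_nonneg s)
        nlinarith
    _ = ((6 * m + C + 2) * s) ^ 2 := by ring
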